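/- Let $\ell\ge 0$ and $N\ge 0$ be integers and let $\mathbf a^{(k)}=\{a^{(k)}(\alpha)\}_{\alpha\in\mathbb Z}$, $k\ge 1$, be real masks, all supported in $\{0,\dots,N\}$. Let $(S_{\mathbf a}\mathbf c)(\alpha)=\sum_{\beta\in\mathbb Z}a(\alpha-2\beta)c(\beta)$ denote the univariate binary subdivision operator and $a^{(k)}_*(z)=\sum_{\alpha}a^{(k)}(\alpha)z^{\alpha}$, $z\in\mathbb C\setminus\{0\}$, the symbols. A scheme $\{S_{\mathbf a^{(k)}},k\ge1\}$ \emph{converges to $C^\ell$ limit functions} if for every $\mathbf c\in\ell_\infty(\mathbb Z)$ there is $g_{\mathbf c}\in C^\ell(\mathbb R)$ (nonzero for at least one nonzero $\mathbf c$) with $$\lim_{k\to\infty}\ \sup_{\alpha\in\mathbb Z}\bigl|g_{\mathbf c}(2^{-k}\alpha)-(S_{\mathbf a^{(k)}}\cdots S_{\mathbf a^{(1)}}\mathbf c)(\alpha)\bigr|=0 .$$ A stationary scheme $S_{\mathbf a}$ (all masks equal to $\mathbf a$) is \emph{convergent} if this holds with $\ell=0$; its basic refinable limit function $\phi$ is then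 the continuous limit generated from the Kronecker sequence $\boldsymbol\delta$, $\delta(0)=1$ and $\delta(\alpha)=0$ for $\alpha\ne0$. A compactly supported $f\in L_\infty(\mathbb R)$ is \emph{stable} if there are $0<C_1\le C_2<\infty$ with $C_1\|\mathbf c\|_{\ell_\infty}\le\bigl\|\sum_{\alpha}c(\alpha)f(\cdot-\alpha)\bigr\|_\infty\le C_2\|\mathbf c\|_{\ell_\infty}$ for all $\mathbf c\in\ell_\infty(\mathbb Z)$. \textbf{Theorem.} Assume that $\mathbf a=\lim_{k\to\infty}\mathbf a^{(k)}$, that the stationary scheme $S_{\mathbf a}$ is convergent with stable basic refinable limit function, and that the non-stationary scheme $\{S_{\mathbf a^{(k)}},k\ge1\}$ converges to $C^\ell$ limit functions. Then the sum rule defects $$\delta_k:=\max_{0\le j\le\ell}2^{-kj}\bigl|D^j a^{(k)}_*(-1)\bigr|,\qquad k\ge1,$$ satisfy $\lim_{k\to\infty}2^{\ell k}\delta_k=0$, i.e. $\delta_k=o(2^{-\ell k})$. -/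

import Mathlib

open Filter Topology MeasureTheory
open scoped ENNReal NNReal

namespace Subdivision

/-- The binary univariate subdivision operator with mask `a`:
`(S_a c)(α) = ∑_β a(α - 2β) c(β)` (a finite sum when `a` has finite support). -/
noncomputable def subdivOp (a c : ℤ → ℝ) : ℤ → ℝ :=
  fun α => ∑ᶠ β : ℤ, a (α - 2 * β) * c β

/-- The data after `k` refinement steps, `S_{a^(k)} ⋯ S_{a^(1)} c`. Masks are numbered from `1`;
the entry `a 0` of the sequence is never used. -/
noncomputable def refine (a : ℕ → ℤ → ℝ) (c : ℤ → ℝ) : ℕ → ℤ → ℝ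
  | 0 => c
  | k + 1 => subdivOp (a (k + 1)) (refine a c k)

/-- Membership in `ℓ_∞(ℤ)`. -/
def IsBoundedSeq (c : ℤ → ℝ) : Prop := ∃ B : ℝ, ∀ α, |c α| ≤ B

/-- `‖g(2^{-k} α) - S_{a^(k)} ⋯ S_{a^(1)} c (α)‖_{ℓ_∞} → 0` as `k → ∞`. -/
def IsLimit (a : ℕ → ℤ → ℝ) (c : ℤ → ℝ) (g : ℝ → ℝ) : Prop :=
  ∀ ε > 0, ∀ᶠ k : ℕ in atTop, ∀ α : ℤ, |g ((α : ℝ) / 2 ^ k) - refine a c k α| ≤ ε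

/-- The scheme with masks `a 1, a 2, …` converges to `C^ℓ` limit functions: every bounded initial
sequence has a `C^ℓ` limit function, which is nonzero for at least one nonzero sequence. -/
def ConvergesToLimits (ℓ : ℕ) (a : ℕ → ℤ → ℝ) : Prop :=
  (∀ c, IsBoundedSeq c → ∃ g : ℝ → ℝ, ContDiff ℝ ℓ g ∧ IsLimit a c g) ∧
  ∃ (c : ℤ → ℝ) (g : ℝ → ℝ), IsBoundedSeq c ∧ c ≠ 0 ∧ ContDiff ℝ ℓ g ∧ IsLimit a c g ∧ g ≠ 0

/-- `φ` is the basic (refinable) limit function of the stationary scheme `S_a`: the continuous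
limit function generated from the Kronecker delta sequence. -/
def IsBasicLimitFunction (a : ℤ → ℝ) (φ : ℝ → ℝ) : Prop :=
  Continuous φ ∧ IsLimit (fun _ => a) (Pi.single 0 1) φ

/-- Stability of a compactly supported `f ∈ L_∞(ℝ)`: for some `0 < C₁ ≤ C₂ < ∞`,
`C₁ ‖c‖_{ℓ_∞} ≤ ‖∑_α c(α) f(· - α)‖_∞ ≤ C₂ ‖c‖_{ℓ_∞}` for all bounded `c`. -/
def IsStable (f : ℝ → ℝ) : Prop :=
  HasCompactSupport f ∧ MemLp f ∞ volume ∧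
  ∃ C₁ C₂ : ℝ≥0, 0 < C₁ ∧ C₁ ≤ C₂ ∧ ∀ c : ℤ → ℝ, IsBoundedSeq c →
    (C₁ : ℝ≥0∞) * (⨆ α, ‖c α‖ₑ) ≤ eLpNorm (fun x : ℝ => ∑ᶠ α : ℤ, c α * f (x - α)) ∞ volume ∧
    eLpNorm (fun x : ℝ => ∑ᶠ α : ℤ, c α * f (x - α)) ∞ volume ≤ (C₂ : ℝ≥0∞) * (⨆ α, ‖c α‖ₑ)

/-- The symbol `a_*(z) = ∑_α a(α) z^α` (used for finitely supported `a` and `z ≠ 0`). -/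
noncomputable def symbol (a : ℤ → ℝ) (z : ℂ) : ℂ := ∑ᶠ α : ℤ, (a α : ℂ) * z ^ α

/-- The sum rule defect at level `k`, for the mask `a` of that level:
`δ_k = max_{0 ≤ j ≤ ℓ} 2^{-kj} |D^j a_*(-1)|`. -/
noncomputable def sumRuleDefect (ℓ k : ℕ) (a : ℤ → ℝ) : ℝ :=
  (Finset.range (ℓ + 1)).sup' Finset.nonempty_range_add_one
    fun j => ‖iteratedDeriv j (symbol a) (-1)‖ / 2 ^ (k * j)

end Subdivision

namespace Subdivision

open Function

/-! Let `Φ k` be the basic limit function of the scheme restarted after level `k`. The refinement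
equation writes the samples `Φ 0 ((y + β) / 2 ^ k)` as the convolution of `Φ k (y + ·)` with the
level-`k` data of the Kronecker sequence. Alternating sums of samples of a compactly supported `C^ℓ`
function at step `h` are `o(h ^ (ℓ - 1))` (`exists_mul_abs_altSum_le`); applied to `x ^ j * Φ 0 x`,
this makes the alternating moments of the left side small. By the binomial theorem
(`altMoment_aryOp`) they are triangular combinations of the alternating moments of the data, with
coefficients from `Φ k`. The diagonal coefficient tends to the alternating sum of `φ (y + ·)`, which
stability makes nonzero for some `y`. Inverting the triangular system shows that the data have small
alternating moments.

The same device is then applied to a single step. A binary step moves the old data by even shifts,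
which do not alternate, so the data enter through ordinary moments, the zeroth being comparable to
`2 ^ k`. A second inversion (`tendsto_altMoment_mask`) bounds the alternating moments of the masks,
and these control the derivatives of the symbols at `-1`.

This needs the functions `Φ k` to exist and to converge to `φ`. Existence follows by deconvolution
with the first mask (`exists_isLimit_tail_one`). For convergence
(`eventually_abs_limit_tail_sub_le`) the nearby masks need not reproduce constants. The data are
therefore divided by reference data taken near a point where some limit `g` is nonzero. The
quotients follow a constant-reproducing scheme close to the stationary one, and the error of each
step is proportional to their first differences, which decay geometrically. -/

/-! ### Subdivision operators of arbitrary arity, their composition and supports. -/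

/-- The subdivision operator of arity `M` with mask `b`. -/
noncomputable def aryOp (M : ℤ) (b f : ℤ → ℝ) : ℤ → ℝ :=
  fun α => ∑ᶠ γ : ℤ, b (α - M * γ) * f γ

/-- The Kronecker sequence. -/
noncomputable def kron : ℤ → ℝ := Pi.single 0 1

/-- The sequence of masks starting after level `k`. -/
def tailMasks (k : ℕ) (a : ℕ → ℤ → ℝ) : ℕ → ℤ → ℝ := fun i => a (k + i)

/-- All masks from level `1` on are supported in `{0, …, N}`. -/
def MasksIn (N : ℕ) (a : ℕ → ℤ → ℝ) : Prop :=
  ∀ k, 1 ≤ k → support (a k) ⊆ Set.Icc (0 : ℤ) N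

lemma MasksIn.tail {N : ℕ} {a : ℕ → ℤ → ℝ} (h : MasksIn N a) (k : ℕ) :
    MasksIn N (tailMasks k a) := fun i hi => h (k + i) (by omega)

lemma tailMasks_tailMasks (k i : ℕ) (a : ℕ → ℤ → ℝ) :
    tailMasks i (tailMasks k a) = tailMasks (k + i) a := by
  funext j; simp [tailMasks, add_assoc]

/-- The window may be longer than necessary, so that neighbouring values of `α` can be expanded over
the same indices. -/
lemma aryOp_eq_sum_window {M : ℤ} (hM : 0 < M) {N : ℕ} {b : ℤ → ℝ}
    (hb : support b ⊆ Set.Icc 0 (M * N)) (f : ℤ → ℝ) {α t : ℤ} {L : ℕ}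
    (h1 : α < M * (t + 1)) (h2 : M * (t - L + N) < α) :
    aryOp M b f α = ∑ m ∈ Finset.range L, b (α - M * (t - m)) * f (t - m) := by
  have hinj : Set.InjOn (fun m : ℕ => t - (m : ℤ)) (Finset.range L : Set ℕ) := by
    intro x _ y _ h; simpa using h
  rw [aryOp, finsum_eq_sum_of_support_subset (s := (Finset.range L).image fun m : ℕ => t - (m : ℤ)),
    Finset.sum_image hinj]
  intro γ hγ
  have hb' : b (α - M * γ) ≠ 0 := left_ne_zero_of_mul hγ
  obtain ⟨h3, h4⟩ := hb hb'
  have h5 : γ < t + 1 := lt_of_mul_lt_mul_left (by linarith : M * γ < M * (t + 1)) hM.le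
  have h6 : t - L < γ := by
    refine lt_of_mul_lt_mul_left (?_ : M * (t - L) < M * γ) hM.le
    linarith [mul_add M (t - L) (N : ℤ)]
  simp only [Finset.coe_image, Finset.coe_range, Set.mem_image, Set.mem_Iio]
  exact ⟨(t - γ).toNat, by omega, by omega⟩

lemma aryOp_eq_sum {M : ℤ} (hM : 0 < M) {N : ℕ} {b : ℤ → ℝ}
    (hb : support b ⊆ Set.Icc 0 (M * N)) (f : ℤ → ℝ) (α : ℤ) :
    aryOp M b f α =
      ∑ m ∈ Finset.range (N + 1), b (α - M * (α / M - m)) * f (α / M - m) := by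
  have h1 := Int.emod_add_mul_ediv α M
  have h2 := Int.emod_nonneg α hM.ne'
  have h3 := Int.emod_lt_of_pos α hM
  apply aryOp_eq_sum_window hM hb
  · linarith [mul_add M (α / M) 1]
  · push_cast
    have : M * (α / M - (N + 1) + N) = M * (α / M) - M := by ring
    rw [this]; linarith

lemma finsum_swap {F : ℤ → ℤ → ℝ} (h : (support (uncurry F)).Finite) :
    ∑ᶠ x, ∑ᶠ y, F x y = ∑ᶠ y, ∑ᶠ x, F x y := by
  have h1 := finsum_curry (uncurry F) h
  have h2 := finsum_curry (fun p : ℤ × ℤ => F p.2 p.1) (by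
    have : (fun p : ℤ × ℤ => F p.2 p.1) = uncurry F ∘ Prod.swap := by
      funext p; simp [uncurry]
    rw [this]
    exact h.preimage (Prod.swap_injective.injOn))
  have h3 := finsum_comp_equiv (Equiv.prodComm ℤ ℤ) (f := uncurry F)
  simp only [uncurry] at h1 h2 h3
  rw [← h1, ← h2, ← h3]
  rfl

/-- Summing a weight against `aryOp M b f` after interchanging the order of summation. -/
lemma finsum_mul_aryOp {M : ℤ} {w b f : ℤ → ℝ}
    (h : (support fun p : ℤ × ℤ => w p.1 * (b (p.1 - M * p.2) * f p.2)).Finite) :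
    ∑ᶠ α, w α * aryOp M b f α = ∑ᶠ γ, (∑ᶠ τ, w (τ + M * γ) * b τ) * f γ := by
  simp only [aryOp, mul_finsum]
  rw [finsum_swap (F := fun α γ => w α * (b (α - M * γ) * f γ)) h]
  refine finsum_congr fun γ => ?_
  rw [finsum_mul, ← finsum_comp_equiv (Equiv.addRight (M * γ))]
  refine finsum_congr fun τ => ?_
  simp [mul_assoc]

lemma finite_support_of_left {M : ℤ} (hM : 0 < M) {w b f : ℤ → ℝ} (hw : (support w).Finite)
    (hb : (support b).Finite) :
    (support fun p : ℤ × ℤ => w p.1 * (b (p.1 - M * p.2) * f p.2)).Finite := by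
  have hinj : Set.InjOn (fun p : ℤ × ℤ => (p.1, p.1 - M * p.2)) Set.univ := by
    rintro ⟨x, y⟩ _ ⟨x', y'⟩ _ h
    simp only [Prod.mk.injEq] at h
    obtain ⟨rfl, h⟩ := h
    have : M * y = M * y' := by linarith
    simpa using mul_left_cancel₀ hM.ne' this
  refine ((hw.prod hb).preimage (hinj.mono (Set.subset_univ _))).subset ?_
  intro p hp
  have hp' : w p.1 * (b (p.1 - M * p.2) * f p.2) ≠ 0 := hp
  exact ⟨left_ne_zero_of_mul hp', left_ne_zero_of_mul (right_ne_zero_of_mul hp')⟩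

lemma finite_support_of_right {M : ℤ} {w b f : ℤ → ℝ} (hb : (support b).Finite)
    (hf : (support f).Finite) :
    (support fun p : ℤ × ℤ => w p.1 * (b (p.1 - M * p.2) * f p.2)).Finite := by
  have hinj : Set.InjOn (fun p : ℤ × ℤ => (p.1 - M * p.2, p.2)) Set.univ := by
    rintro ⟨x, y⟩ _ ⟨x', y'⟩ _ h
    simp only [Prod.mk.injEq] at h
    obtain ⟨h, rfl⟩ := h
    simpa using h
  refine ((hb.prod hf).preimage (hinj.mono (Set.subset_univ _))).subset ?_
  intro p hp
  have hp' : w p.1 * (b (p.1 - M * p.2) * f p.2) ≠ 0 := hp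
  exact ⟨left_ne_zero_of_mul (right_ne_zero_of_mul hp'),
    right_ne_zero_of_mul (right_ne_zero_of_mul hp')⟩

/-- Through this, a block of `n` binary steps becomes one step of arity `2 ^ n`, whose contraction
factor can be made as small as required. -/
lemma aryOp_aryOp {M M' : ℤ} (hM : 0 < M) (hM' : 0 < M') {b b' : ℤ → ℝ}
    (hb : (support b).Finite) (hb' : (support b').Finite) (f : ℤ → ℝ) :
    aryOp M b (aryOp M' b' f) = aryOp (M * M') (aryOp M b b') f := by
  funext α
  have hw : (support fun β => b (α - M * β)).Finite := by
    refine hb.preimage (Set.injOn_of_injective fun x y h => ?_)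
    have : M * x = M * y := by simpa using h
    exact mul_left_cancel₀ hM.ne' this
  have h := finsum_mul_aryOp (finite_support_of_left (f := f) hM' hw hb')
  rw [aryOp, h]
  refine finsum_congr fun γ => ?_
  rw [aryOp]
  congr 1
  refine finsum_congr fun τ => ?_
  congr 2
  ring

lemma aryOp_kron (M : ℤ) (b : ℤ → ℝ) : aryOp M b kron = b := by
  funext α
  rw [aryOp, finsum_eq_single _ 0]
  · simp [kron]
  · intro x hx; simp [kron, hx]

lemma aryOp_one_kron (f : ℤ → ℝ) : aryOp 1 kron f = f := by
  funext α
  rw [aryOp, finsum_eq_single _ α]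
  · simp [kron]
  · intro x hx
    have : α - x ≠ 0 := by omega
    simp [kron, this]

lemma finite_support_of_subset_Icc {f : ℤ → ℝ} {x y : ℤ} (h : support f ⊆ Set.Icc x y) :
    (support f).Finite := (Set.finite_Icc x y).subset h

lemma support_aryOp_subset {M L L' : ℤ} {b f : ℤ → ℝ} (hM : 0 < M)
    (hb : support b ⊆ Set.Icc 0 L) (hf : support f ⊆ Set.Icc 0 L') :
    support (aryOp M b f) ⊆ Set.Icc 0 (M * L' + L) := by
  intro α hα
  obtain ⟨γ, hγ⟩ : ∃ γ, b (α - M * γ) * f γ ≠ 0 := by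
    by_contra! h
    exact hα (by simp [aryOp, h])
  obtain ⟨h1, h2⟩ := hb (left_ne_zero_of_mul hγ)
  obtain ⟨h3, h4⟩ := hf (right_ne_zero_of_mul hγ)
  have h5 := mul_nonneg hM.le h3
  have h6 := mul_le_mul_of_nonneg_left h4 hM.le
  constructor <;> linarith

/-- The factor `2 ^ i - 1` is the geometric sum of the mask lengths. Bounds of the shape `(M - 1) *
N` compose exactly: `M * ((H - 1) * N) + (M - 1) * N = (M * H - 1) * N`. -/
lemma support_refine_kron {N : ℕ} {a : ℕ → ℤ → ℝ} (ha : MasksIn N a) (i : ℕ) :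
    support (refine a kron i) ⊆ Set.Icc (0 : ℤ) ((2 ^ i - 1) * N) := by
  induction i with
  | zero =>
    intro x hx
    have : x = 0 := by
      by_contra h
      exact hx (by simp [refine, kron, h])
    simp [this]
  | succ i ih =>
    have h := support_aryOp_subset (M := 2) (by norm_num) (ha (i + 1) (by omega)) ih
    refine h.trans (Set.Icc_subset_Icc le_rfl (le_of_eq ?_))
    ring

lemma support_refine_kron' {N : ℕ} {a : ℕ → ℤ → ℝ} (ha : MasksIn N a) (i : ℕ) :
    support (refine a kron i) ⊆ Set.Icc (0 : ℤ) (2 ^ i * N) :=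
  (support_refine_kron ha i).trans (Set.Icc_subset_Icc le_rfl (by
    have : (0 : ℤ) ≤ N := by positivity
    linarith [sub_mul (2 ^ i : ℤ) 1 N]))

lemma finite_support_refine_kron {N : ℕ} {a : ℕ → ℤ → ℝ} (ha : MasksIn N a) (i : ℕ) :
    (support (refine a kron i)).Finite :=
  finite_support_of_subset_Icc (support_refine_kron ha i)

/-- Splitting off the first `k` refinement steps. -/
lemma refine_add {N : ℕ} {a : ℕ → ℤ → ℝ} (ha : MasksIn N a) (c : ℤ → ℝ) (k i : ℕ) :
    refine a c (k + i) = aryOp (2 ^ i) (refine (tailMasks k a) kron i) (refine a c k) := by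
  induction i with
  | zero => rw [pow_zero]; exact (aryOp_one_kron _).symm
  | succ i ih =>
    have h1 : refine a c (k + (i + 1)) = aryOp 2 (a (k + i + 1)) (refine a c (k + i)) := rfl
    have h2 : refine (tailMasks k a) kron (i + 1)
        = aryOp 2 (a (k + i + 1)) (refine (tailMasks k a) kron i) := rfl
    rw [h1, h2, ih, aryOp_aryOp (by norm_num) (by positivity)
      (finite_support_of_subset_Icc (ha (k + i + 1) (by omega)))
      (finite_support_refine_kron (ha.tail k) i), pow_succ, mul_comm]

lemma refine_kron_one (a : ℕ → ℤ → ℝ) : refine a kron 1 = a 1 := aryOp_kron _ _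

/-! ### Pointwise consequences of convergence, and the refinement equation. -/

lemma isLimit_tendsto {a : ℕ → ℤ → ℝ} {c : ℤ → ℝ} {g : ℝ → ℝ} (h : IsLimit a c g) {x : ℝ}
    (hg : ContinuousAt g x) {p : ℕ → ℤ}
    (hp : Tendsto (fun s => (p s : ℝ) / 2 ^ s) atTop (𝓝 x)) :
    Tendsto (fun s => refine a c s (p s)) atTop (𝓝 (g x)) := by
  have h1 : Tendsto (fun s => g ((p s : ℝ) / 2 ^ s)) atTop (𝓝 (g x)) := hg.tendsto.comp hp
  have h2 : Tendsto (fun s => refine a c s (p s) - g ((p s : ℝ) / 2 ^ s)) atTop (𝓝 0) := by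
    rw [Metric.tendsto_nhds]
    intro ε hε
    filter_upwards [h (ε / 2) (by positivity)] with s hs
    rw [Real.dist_eq, sub_zero, abs_sub_comm]
    linarith [hs (p s)]
  simpa using h2.add h1

lemma tendsto_floor_div_two_pow (x : ℝ) :
    Tendsto (fun s : ℕ => ((⌊x * 2 ^ s⌋ : ℤ) : ℝ) / 2 ^ s) atTop (𝓝 x) := by
  have h0 : Tendsto (fun s : ℕ => x - (1 / 2 : ℝ) ^ s) atTop (𝓝 x) := by
    simpa using (tendsto_const_nhds (x := x)).sub
      (tendsto_pow_atTop_nhds_zero_of_lt_one (r := (1 / 2 : ℝ)) (by norm_num) (by norm_num))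
  refine tendsto_of_tendsto_of_tendsto_of_le_of_le h0 tendsto_const_nhds ?_ ?_
  · intro s
    have := (Int.lt_floor_add_one (x * 2 ^ s)).le
    simp only
    rw [le_div_iff₀ (by positivity), sub_mul, ← mul_pow]
    norm_num
    linarith
  · intro s
    simp only
    rw [div_le_iff₀ (by positivity)]
    exact Int.floor_le _

lemma isLimit_tendsto_floor {a : ℕ → ℤ → ℝ} {c : ℤ → ℝ} {g : ℝ → ℝ} (h : IsLimit a c g)
    (hg : Continuous g) (x : ℝ) :
    Tendsto (fun s => refine a c s ⌊x * 2 ^ s⌋) atTop (𝓝 (g x)) :=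
  isLimit_tendsto h hg.continuousAt (tendsto_floor_div_two_pow x)

lemma isLimit_kron_eq_zero {N : ℕ} {a : ℕ → ℤ → ℝ} (ha : MasksIn N a) {Φ : ℝ → ℝ}
    (hc : Continuous Φ) (h : IsLimit a kron Φ) {x : ℝ} (hx : x ∉ Set.Icc (0 : ℝ) N) :
    Φ x = 0 := by
  have h1 := isLimit_tendsto_floor h hc x
  refine tendsto_nhds_unique h1 (tendsto_const_nhds.congr' ?_)
  have key : ∀ᶠ s : ℕ in atTop, ⌊x * 2 ^ s⌋ ∉ Set.Icc (0 : ℤ) (2 ^ s * N) := by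
    have h2 := (tendsto_floor_div_two_pow x).eventually
      (isClosed_Icc.isOpen_compl.mem_nhds (Set.mem_compl hx))
    filter_upwards [h2] with s hs hm
    apply hs
    obtain ⟨h3, h4⟩ := hm
    have h3' : (0 : ℝ) ≤ (⌊x * 2 ^ s⌋ : ℤ) := by exact_mod_cast h3
    have h4' : ((⌊x * 2 ^ s⌋ : ℤ) : ℝ) ≤ 2 ^ s * N := by exact_mod_cast h4
    exact ⟨by positivity, by rw [div_le_iff₀ (by positivity)]; linarith⟩
  filter_upwards [key] with s hs
  by_contra hne
  exact hs (support_refine_kron' ha s (Ne.symm hne))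

/-- The refinement equation relating the basic limit functions at levels `0` and `k`. -/
lemma isLimit_kron_refinement {N : ℕ} {a : ℕ → ℤ → ℝ} (ha : MasksIn N a) {Φ Φk : ℝ → ℝ} {k : ℕ}
    (hc : Continuous Φ) (h : IsLimit a kron Φ) (hck : Continuous Φk)
    (hk : IsLimit (tailMasks k a) kron Φk) (x : ℝ) :
    Φ x = ∑ᶠ γ : ℤ, Φk (2 ^ k * x - γ) * refine a kron k γ := by
  have h1 := (isLimit_tendsto_floor h hc x).comp (tendsto_add_atTop_nat k)
  have hfin := finite_support_refine_kron ha k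
  have hs : ∀ F : ℤ → ℝ, ∑ᶠ γ, F γ * refine a kron k γ
      = ∑ γ ∈ hfin.toFinset, F γ * refine a kron k γ := fun F =>
    finsum_eq_sum_of_support_subset _ fun γ hγ => by
      simpa using right_ne_zero_of_mul hγ
  rw [hs]
  refine tendsto_nhds_unique h1 ?_
  have h2 : Tendsto (fun i => ∑ γ ∈ hfin.toFinset,
      refine (tailMasks k a) kron i ⌊(2 ^ k * x - γ) * 2 ^ i⌋ * refine a kron k γ) atTop
      (𝓝 (∑ γ ∈ hfin.toFinset, Φk (2 ^ k * x - γ) * refine a kron k γ)) :=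
    tendsto_finsetSum _ fun γ _ => (isLimit_tendsto_floor hk hck _).mul_const _
  refine h2.congr fun i => ?_
  simp only [comp]
  rw [← hs (fun γ : ℤ => refine (tailMasks k a) kron i ⌊(2 ^ k * x - γ) * 2 ^ i⌋), add_comm i k,
    refine_add ha]
  refine finsum_congr fun γ => ?_
  congr 2
  rw [eq_sub_iff_add_eq, ← Int.floor_add_intCast]
  congr 1
  push_cast
  ring

/-! ### Deconvolution: limit functions of the tail schemes. -/

lemma exists_convolution_inverse (A : ℕ → ℝ) (h : A 0 ≠ 0) :
    ∃ r : ℕ → ℝ, ∀ n, ∑ k ∈ Finset.range (n + 1), r k * A (n - k) = if n = 0 then 1 else 0 := by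
  refine ⟨fun n => PowerSeries.coeff n (PowerSeries.mk A)⁻¹, fun n => ?_⟩
  have h1 : (PowerSeries.mk A)⁻¹ * PowerSeries.mk A = 1 :=
    PowerSeries.inv_mul_cancel _ (by simpa using h)
  have h2 := congrArg (PowerSeries.coeff n) h1
  rw [PowerSeries.coeff_mul, Finset.Nat.sum_antidiagonal_eq_sum_range_succ_mk,
    PowerSeries.coeff_one] at h2
  simpa using h2

/-- Regrouped along `p + q = n`, the coefficient of `T n` is the convolution of `r` and `A`, which
is `1` at `n = 0` and `0` otherwise. Because `T` vanishes from `P` on, the infinite inverse `r` is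
only needed up to `P`. -/
lemma sum_convolution_inverse {A r : ℕ → ℝ}
    (h : ∀ n, ∑ k ∈ Finset.range (n + 1), r k * A (n - k) = if n = 0 then 1 else 0)
    {P : ℕ} (hP : 0 < P) {T : ℕ → ℝ} (hT : ∀ n, P ≤ n → T n = 0) :
    ∑ p ∈ Finset.range P, r p * ∑ q ∈ Finset.range P, T (p + q) * A q = T 0 := by
  have h1 : ∀ p ∈ Finset.range P, r p * ∑ q ∈ Finset.range P, T (p + q) * A q
      = ∑ q ∈ Finset.range (P - p), r p * (T (p + q) * A q) := by
    intro p _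
    rw [Finset.mul_sum]
    symm
    refine Finset.sum_subset (by simp) fun q _ hq => ?_
    rw [hT (p + q) (by simp at hq; omega)]
    simp
  rw [Finset.sum_congr rfl h1,
    ← Finset.sum_range_diag_flip P (fun p q => r p * (T (p + q) * A q))]
  have h2 : ∀ n ∈ Finset.range P,
      ∑ k ∈ Finset.range (n + 1), r k * (T (k + (n - k)) * A (n - k))
        = T n * if n = 0 then 1 else 0 := by
    intro n _
    rw [← h n, Finset.mul_sum]
    refine Finset.sum_congr rfl fun k hk => ?_
    rw [Nat.add_sub_cancel' (by simp at hk; omega)]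
    ring
  rw [Finset.sum_congr rfl h2, Finset.sum_eq_single 0]
  · simp
  · intro n _ hn; simp [hn]
  · intro h0; simp [hP.ne'] at h0

/-- If the first mask is nonzero, then the data generated by the remaining scheme are locally
combinations of the data generated by the whole scheme. -/
lemma exists_refine_tail_eq {N : ℕ} {a : ℕ → ℤ → ℝ} (ha : MasksIn N a) (h1 : a 1 ≠ 0) :
    ∃ (n₀ : ℤ) (r : ℕ → ℝ), ∀ (i : ℕ) (β : ℤ), β < 2 ^ i * (N + 2) →
      refine (tailMasks 1 a) kron i β
        = ∑ p ∈ Finset.range (N + 2), r p * refine a kron (i + 1) (β + 2 ^ i * (n₀ - p)) := by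
  have hne : ∃ n : ℕ, a 1 n ≠ 0 := by
    obtain ⟨x, hx⟩ := Function.ne_iff.1 h1
    obtain ⟨h2, h3⟩ := ha 1 le_rfl hx
    lift x to ℕ using h2
    exact ⟨x, hx⟩
  classical
  set n₀ := Nat.find hne with hn₀
  have hA0 : a 1 n₀ ≠ 0 := Nat.find_spec hne
  have hlt : ∀ x : ℤ, x < n₀ → a 1 x = 0 := by
    intro x hx
    by_contra h
    obtain ⟨h2, h3⟩ := ha 1 le_rfl h
    lift x to ℕ using h2
    exact Nat.find_min hne (by exact_mod_cast hx) h
  obtain ⟨r, hr⟩ := exists_convolution_inverse (fun q => a 1 (n₀ + q)) (by simpa using hA0)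
  refine ⟨n₀, r, fun i β hβ => ?_⟩
  have hT := sum_convolution_inverse (A := fun q : ℕ => a 1 (n₀ + q)) hr (P := N + 2) (by omega)
    -- For `n ≥ N + 2` the index `β - 2 ^ i * n` is negative, hence outside the support.
    (T := fun n => refine (tailMasks 1 a) kron i (β - 2 ^ i * n)) (by
      intro n hn
      by_contra h
      have h2 := (support_refine_kron' (ha.tail 1) i h).1
      have h3 : (2 : ℤ) ^ i * (N + 2) ≤ 2 ^ i * n :=
        mul_le_mul_of_nonneg_left (by exact_mod_cast hn) (by positivity)
      linarith)
  simp only [Nat.cast_zero, mul_zero, sub_zero] at hT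
  rw [← hT]
  refine Finset.sum_congr rfl fun p _ => ?_
  congr 1
  rw [add_comm i 1, refine_add ha, refine_kron_one, aryOp,
    finsum_eq_sum_of_support_subset (s := (Finset.range (N + 2)).image fun q : ℕ => (n₀ : ℤ) + q),
    Finset.sum_image (by intro x _ y _ h; simpa using h)]
  · refine Finset.sum_congr rfl fun q _ => ?_
    congr 2
    push_cast
    ring
  · intro γ hγ
    have h2 := right_ne_zero_of_mul hγ
    have h3 : ¬ γ < n₀ := fun h => h2 (hlt γ h)
    have h4 := (ha 1 le_rfl h2).2
    simp only [Finset.coe_image, Finset.coe_range, Set.mem_image, Set.mem_Iio]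
    exact ⟨(γ - n₀).toNat, by omega, by omega⟩

/-- The deconvolution formula suggests the limit `F`, a finite combination of translated dilates of
`Φ`, but it is valid only to the left of `N + 2`. Since the tail data vanish beyond `N`, so does `F`
on `(N, N + 2)`. -/
lemma exists_isLimit_tail_one {ℓ N : ℕ} {a : ℕ → ℤ → ℝ} (ha : MasksIn N a) (h1 : a 1 ≠ 0)
    {Φ : ℝ → ℝ} (hΦ : ContDiff ℝ ℓ Φ) (hlim : IsLimit a kron Φ) :
    ∃ Φ' : ℝ → ℝ, ContDiff ℝ ℓ Φ' ∧ IsLimit (tailMasks 1 a) kron Φ' := by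
  obtain ⟨n₀, r, hr⟩ := exists_refine_tail_eq ha h1
  set F : ℝ → ℝ := fun x => ∑ p ∈ Finset.range (N + 2), r p * Φ ((x + (n₀ - p)) / 2) with hF
  have hFc : ContDiff ℝ ℓ F := by
    refine ContDiff.sum fun p _ => contDiff_const.mul (hΦ.comp ?_)
    fun_prop
  have hFd : ∀ (i : ℕ) (β : ℤ), F ((β : ℝ) / 2 ^ i) = ∑ p ∈ Finset.range (N + 2),
      r p * Φ (((β + 2 ^ i * (n₀ - p) : ℤ) : ℝ) / 2 ^ (i + 1)) := by
    intro i β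
    refine Finset.sum_congr rfl fun p _ => ?_
    congr 2
    push_cast
    rw [pow_succ]
    field_simp
  -- `F` approximates the data to the left of `N + 2`
  have hapx : ∀ ε > 0, ∀ᶠ i : ℕ in atTop, ∀ β : ℤ, β < 2 ^ i * (N + 2) →
      |F ((β : ℝ) / 2 ^ i) - refine (tailMasks 1 a) kron i β| ≤ ε := by
    intro ε hε
    set B := 1 + ∑ p ∈ Finset.range (N + 2), |r p| with hB
    have hBpos : 0 < B := by positivity
    filter_upwards [(tendsto_add_atTop_nat 1).eventually (hlim (ε / B) (by positivity))]
      with i hi β hβ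
    rw [hFd, hr i β hβ, ← Finset.sum_sub_distrib]
    calc |∑ p ∈ Finset.range (N + 2), (r p * Φ (((β + 2 ^ i * (n₀ - p) : ℤ) : ℝ) / 2 ^ (i + 1))
          - r p * refine a kron (i + 1) (β + 2 ^ i * (n₀ - p)))|
        ≤ ∑ p ∈ Finset.range (N + 2), |r p| * (ε / B) := by
          refine (Finset.abs_sum_le_sum_abs _ _).trans (Finset.sum_le_sum fun p _ => ?_)
          rw [← mul_sub, abs_mul]
          exact mul_le_mul_of_nonneg_left (hi _) (abs_nonneg _)
      _ = (B - 1) * (ε / B) := by rw [← Finset.sum_mul, hB]; ring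
      _ ≤ B * (ε / B) := by gcongr; linarith
      _ = ε := by field_simp
  have hF0 : ∀ x : ℝ, N < x → x < N + 2 → F x = 0 := by
    intro x hx1 hx2
    have hp := tendsto_floor_div_two_pow x
    have h2 : Tendsto (fun s : ℕ => F (((⌊x * 2 ^ s⌋ : ℤ) : ℝ) / 2 ^ s)) atTop (𝓝 (F x)) :=
      (hFc.continuous.tendsto x).comp hp
    refine tendsto_nhds_unique h2 ?_
    rw [Metric.tendsto_nhds]
    intro ε hε
    filter_upwards [hapx (ε / 2) (by positivity), hp.eventually (Ioo_mem_nhds hx1 hx2)]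
      with s hs ⟨h3, h4⟩
    rw [lt_div_iff₀ (by positivity)] at h3
    rw [div_lt_iff₀ (by positivity)] at h4
    have h3' : (2 : ℤ) ^ s * N < ⌊x * 2 ^ s⌋ := by
      rw [mul_comm ((2 : ℤ) ^ s)]; exact_mod_cast h3
    have h4' : ⌊x * 2 ^ s⌋ < (2 : ℤ) ^ s * (N + 2) := by
      rw [mul_comm ((2 : ℤ) ^ s)]; exact_mod_cast h4
    have h5 : refine (tailMasks 1 a) kron s ⌊x * 2 ^ s⌋ = 0 := by
      by_contra h
      exact absurd (support_refine_kron' (ha.tail 1) s h).2 (not_le.2 h3')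
    have h6 := hs _ h4'
    rw [h5] at h6
    rw [Real.dist_eq]
    linarith
  -- The cut at `N + 1` lies inside the interval where `F` is zero, so smoothness is kept.
  refine ⟨fun x => if x < N + 1 then F x else 0, ?_, ?_⟩
  · rw [contDiff_iff_contDiffAt]
    intro x
    rcases lt_or_ge (N : ℝ) x with hx | hx
    · refine contDiffAt_const (c := (0 : ℝ)) |>.congr_of_eventuallyEq ?_
      filter_upwards [Ioi_mem_nhds hx] with y hy
      split_ifs with h
      · exact hF0 y hy (by linarith)
      · rfl
    · refine hFc.contDiffAt.congr_of_eventuallyEq ?_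
      filter_upwards [Iio_mem_nhds (show x < (N : ℝ) + 1 by linarith)] with y hy
      exact if_pos hy
  · intro ε hε
    filter_upwards [hapx ε hε] with i hi β
    split_ifs with h
    · refine hi β ?_
      rw [div_lt_iff₀ (by positivity)] at h
      have h' : β < ((N : ℤ) + 1) * 2 ^ i := by exact_mod_cast h
      have : (0 : ℤ) < 2 ^ i := by positivity
      linarith
    · rw [not_lt, le_div_iff₀ (by positivity)] at h
      have h' : ((N : ℤ) + 1) * 2 ^ i ≤ β := by exact_mod_cast h
      have : refine (tailMasks 1 a) kron i β = 0 := by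
        by_contra hne
        have h3 := (support_refine_kron' (ha.tail 1) i hne).2
        have : (0 : ℤ) < 2 ^ i := by positivity
        linarith
      simp [this, hε.le]

lemma exists_isLimit_tail {ℓ N : ℕ} {a : ℕ → ℤ → ℝ} (ha : MasksIn N a)
    (h1 : ∀ k, 1 ≤ k → a k ≠ 0) {Φ : ℝ → ℝ} (hΦ : ContDiff ℝ ℓ Φ) (hlim : IsLimit a kron Φ)
    (k : ℕ) :
    ∃ Φ' : ℝ → ℝ, ContDiff ℝ ℓ Φ' ∧ IsLimit (tailMasks k a) kron Φ' := by
  induction k with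
  | zero =>
    refine ⟨Φ, hΦ, ?_⟩
    convert hlim using 1
    funext i
    simp [tailMasks]
  | succ k ih =>
    obtain ⟨Φ', h2, h3⟩ := ih
    have := exists_isLimit_tail_one (ha.tail k) (h1 (k + 1) (by omega)) h2 h3
    rwa [tailMasks_tailMasks] at this

lemma refine_eq_zero_of_mask_eq_zero {a : ℕ → ℤ → ℝ} {m : ℕ} (hm : 1 ≤ m) (h : a m = 0)
    (c : ℤ → ℝ) (i : ℕ) : refine a c (m + i) = 0 := by
  induction i with
  | zero =>
    obtain ⟨m, rfl⟩ := Nat.exists_eq_add_of_le' hm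
    funext α
    simp [refine, subdivOp, h]
  | succ i ih =>
    have h2 : refine a c (m + (i + 1)) = subdivOp (a (m + i + 1)) (refine a c (m + i)) := rfl
    funext α
    simp [h2, ih, subdivOp]

/-- A single zero mask annihilates all later data, and with them every limit. -/
lemma mask_ne_zero_of_isLimit {a : ℕ → ℤ → ℝ} {c : ℤ → ℝ} {g : ℝ → ℝ} (hg : Continuous g)
    (hlim : IsLimit a c g) (hne : g ≠ 0) {m : ℕ} (hm : 1 ≤ m) : a m ≠ 0 := by
  intro h
  apply hne
  funext x
  refine tendsto_nhds_unique (isLimit_tendsto_floor hlim hg x) (tendsto_const_nhds.congr' ?_)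
  filter_upwards [eventually_ge_atTop m] with s hs
  obtain ⟨i, rfl⟩ := Nat.exists_eq_add_of_le hs
  rw [refine_eq_zero_of_mask_eq_zero hm h]
  rfl

/-! ### Non-stationary perturbation of a contractive scheme. -/

lemma support_subset_mul {M : ℤ} {N : ℕ} {b : ℤ → ℝ}
    (hb : support b ⊆ Set.Icc 0 ((M - 1) * N)) : support b ⊆ Set.Icc 0 (M * N) :=
  hb.trans (Set.Icc_subset_Icc le_rfl (by nlinarith [Int.natCast_nonneg N]))

lemma abs_sub_le_mul_of_abs_diff_le {f : ℤ → ℝ} {D : ℝ} (h : ∀ α, |f (α + 1) - f α| ≤ D)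
    (t : ℤ) (m : ℕ) : |f (t - m) - f t| ≤ m * D := by
  induction m with
  | zero => simp
  | succ m ih =>
    have h1 := h (t - (m + 1 : ℕ))
    have h2 : t - ((m + 1 : ℕ) : ℤ) + 1 = t - m := by push_cast; ring
    rw [h2, abs_sub_comm] at h1
    calc |f (t - (m + 1 : ℕ)) - f t|
        ≤ |f (t - (m + 1 : ℕ)) - f (t - m)| + |f (t - m) - f t| := abs_sub_le _ _ _
      _ ≤ D + m * D := add_le_add h1 ih
      _ = (m + 1 : ℕ) * D := by push_cast; ring

/-- Two averaging sums with nearby weights differ little on slowly varying data. -/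
lemma abs_sum_sub_sum_le {L : ℕ} {k k' x : ℕ → ℝ} {y E θ : ℝ} (hk : ∑ m ∈ Finset.range L, k m = 1)
    (hk' : ∑ m ∈ Finset.range L, k' m = 1) (hθ : ∀ m ∈ Finset.range L, |k m - k' m| ≤ θ)
    (hE : ∀ m ∈ Finset.range L, |x m - y| ≤ E) :
    |∑ m ∈ Finset.range L, k m * x m - ∑ m ∈ Finset.range L, k' m * x m| ≤ L * (θ * E) := by
  -- Both weights have total mass `1`, so the constant `y` may be subtracted from `x`.
  have h1 : ∑ m ∈ Finset.range L, k m * x m - ∑ m ∈ Finset.range L, k' m * x m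
      = ∑ m ∈ Finset.range L, (k m - k' m) * (x m - y) := by
    have h2 : ∑ m ∈ Finset.range L, (k m - k' m) * y = 0 := by
      rw [← Finset.sum_mul, Finset.sum_sub_distrib, hk, hk']; simp
    simp only [mul_sub, Finset.sum_sub_distrib (f := fun m => (k m - k' m) * x m), h2, sub_zero]
    simp only [sub_mul, Finset.sum_sub_distrib]
  rw [h1]
  refine (Finset.abs_sum_le_sum_abs _ _).trans ?_
  rw [← nsmul_eq_mul]
  refine (Finset.sum_le_card_nsmul _ _ (θ * E) fun m hm => ?_).trans (by simp)
  rw [abs_mul]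
  exact mul_le_mul (hθ m hm) (hE m hm) (abs_nonneg _) ((abs_nonneg _).trans (hθ m hm))

/-- Neighbouring output values are averages of the same `N + 2` inputs with weights differing by at
most `ω`. A slowly varying mask therefore contracts first differences. -/
lemma abs_aryOp_sub_le_of_diff {M : ℤ} (hM : 0 < M) {N : ℕ} {s f : ℤ → ℝ}
    (hs : support s ⊆ Set.Icc 0 (M * N)) (hs1 : ∀ α, aryOp M s (fun _ => 1) α = 1)
    {ω D : ℝ} (hω : ∀ α, |s (α + 1) - s α| ≤ ω) (hD : ∀ α, |f (α + 1) - f α| ≤ D) (α : ℤ) :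
    |aryOp M s f (α + 1) - aryOp M s f α| ≤ ((N : ℝ) + 2) * (ω * ((N + 1) * D)) := by
  set t := (α + 1) / M with ht
  have h1 := Int.emod_add_mul_ediv (α + 1) M
  have h2 := Int.emod_nonneg (α + 1) hM.ne'
  have h3 := Int.emod_lt_of_pos (α + 1) hM
  rw [← ht] at h1
  have w1 : ∀ f, aryOp M s f (α + 1)
      = ∑ m ∈ Finset.range (N + 2), s (α + 1 - M * (t - m)) * f (t - m) := fun f => by
    apply aryOp_eq_sum_window hM hs
    · linarith [mul_add M t 1]
    · push_cast
      have : M * (t - (N + 2) + N) = M * t - 2 * M := by ring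
      rw [this]; linarith
  have w2 : ∀ f, aryOp M s f α
      = ∑ m ∈ Finset.range (N + 2), s (α - M * (t - m)) * f (t - m) := fun f => by
    apply aryOp_eq_sum_window hM hs
    · linarith [mul_add M t 1]
    · push_cast
      have : M * (t - (N + 2) + N) = M * t - 2 * M := by ring
      rw [this]; linarith
  have e1 := hs1 (α + 1)
  have e2 := hs1 α
  rw [w1] at e1
  rw [w2] at e2
  simp only [mul_one] at e1 e2
  rw [w1, w2]
  refine (abs_sum_sub_sum_le (θ := ω) (E := (N + 1) * D) (y := f t) e1 e2 ?_ ?_).trans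
    (by push_cast; exact le_rfl)
  · intro m _
    have := hω (α - M * (t - m))
    rwa [show α - M * (t - m) + 1 = α + 1 - M * (t - m) by ring] at this
  · intro m hm
    refine (abs_sub_le_mul_of_abs_diff_le hD t m).trans ?_
    have : (m : ℝ) ≤ N + 1 := by
      have : m ≤ N + 1 := by simp at hm; omega
      exact_mod_cast this
    exact mul_le_mul_of_nonneg_right this ((abs_nonneg _).trans (hD 0))

lemma abs_weight_sub_le {b s u u' η C : ℝ} (h1 : |b - s| ≤ η) (h2 : |s| ≤ C) (h3 : |u - 1| ≤ η)
    (h4 : |u' - 1| ≤ η) (hη : η ≤ 1 / 2) : |b * u / u' - s| ≤ (3 + 4 * C) * η := by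
  have hη0 : 0 ≤ η := (abs_nonneg _).trans h1
  have hC : 0 ≤ C := (abs_nonneg _).trans h2
  have hu' : 1 / 2 ≤ u' := by linarith [(abs_le.1 h4).1]
  have hu'0 : 0 < u' := by linarith
  have h5 : b * u / u' - s = ((b - s) * u + s * ((u - 1) - (u' - 1))) / u' := by
    field_simp; ring
  rw [h5, abs_div, abs_of_pos hu'0, div_le_iff₀ hu'0]
  have hu : |u| ≤ 3 / 2 := by
    rw [abs_le] at h3 ⊢; constructor <;> linarith [h3.1, h3.2]
  have h6 : |(b - s) * u| ≤ η * (3 / 2) := by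
    rw [abs_mul]; exact mul_le_mul h1 hu (abs_nonneg _) hη0
  have h7 : |s * ((u - 1) - (u' - 1))| ≤ C * (η + η) := by
    rw [abs_mul]
    exact mul_le_mul h2 ((abs_sub _ _).trans (add_le_add h3 h4)) (abs_nonneg _) hC
  have h8 : 0 ≤ (3 + 4 * C) * η := by positivity
  calc _ ≤ η * (3 / 2) + C * (η + η) := (abs_add_le _ _).trans (add_le_add h6 h7)
    _ = (3 + 4 * C) * η * (1 / 2) := by ring
    _ ≤ _ := mul_le_mul_of_nonneg_left hu' h8

/-- One step of a scheme with mask `b` near `s`, divided by a reference solution `U` near `1`,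
is a perturbation of the scheme with mask `s`. -/
lemma abs_quotient_step_le {M H : ℤ} (hM : 0 < M) {N : ℕ} {s b U V : ℤ → ℝ}
    (hs : support s ⊆ Set.Icc 0 ((M - 1) * N)) (hb : support b ⊆ Set.Icc 0 ((M - 1) * N))
    (hs1 : ∀ α, aryOp M s (fun _ => 1) α = 1) {η C D : ℝ} (hη : η ≤ 1 / 2)
    (hbs : ∀ τ, |b τ - s τ| ≤ η) (hsC : ∀ τ, |s τ| ≤ C)
    (hV : support V ⊆ Set.Icc 0 ((H - 1) * N))
    (hU : ∀ γ : ℤ, -N ≤ γ → γ ≤ H * N → |U γ - 1| ≤ η)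
    (hU' : ∀ α : ℤ, 0 ≤ α → α ≤ (M * H - 1) * N → |aryOp M b U α - 1| ≤ η)
    (hD : ∀ α, |V (α + 1) / U (α + 1) - V α / U α| ≤ D) (α : ℤ) :
    |aryOp M b V α / aryOp M b U α - aryOp M s (fun γ => V γ / U γ) α|
      ≤ (N + 1) * (((3 + 4 * C) * η) * (N * D)) := by
  have hη0 : 0 ≤ η := (abs_nonneg _).trans (hbs 0)
  have hC0 : 0 ≤ C := (abs_nonneg _).trans (hsC 0)
  have hD0 : 0 ≤ D := (abs_nonneg _).trans (hD 0)
  by_cases hα : α ∈ Set.Icc (0 : ℤ) ((M * H - 1) * N)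
  · obtain ⟨ha, hb'⟩ := hα
    set t := α / M with ht
    have hbM := support_subset_mul hb
    have hsM := support_subset_mul hs
    have hUα := hU' α ha hb'
    have hUpos : 0 < aryOp M b U α := by linarith [(abs_le.1 hUα).1]
    have ht0 : 0 ≤ t := Int.ediv_nonneg ha hM.le
    have htH : t ≤ H * N := by
      have : t ≤ (M * (H * N)) / M := Int.ediv_le_ediv hM (by nlinarith [Int.natCast_nonneg N])
      rwa [Int.mul_ediv_cancel_left _ hM.ne'] at this
    have hUγ : ∀ m ∈ Finset.range (N + 1), |U (t - m) - 1| ≤ η := fun m hm => by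
      simp at hm
      exact hU _ (by omega) (by linarith [Int.natCast_nonneg m])
    -- The quotient `V / U` is itself subdivided, with weights `b * U / aryOp M b U`. These sum to
    -- `1` by construction, even though those of `b` need not.
    have hVU : aryOp M b V α / aryOp M b U α
        = ∑ m ∈ Finset.range (N + 1),
          (b (α - M * (t - m)) * U (t - m) / aryOp M b U α) * (V (t - m) / U (t - m)) := by
      rw [aryOp_eq_sum hM hbM V, Finset.sum_div]
      refine Finset.sum_congr rfl fun m hm => ?_
      have : U (t - m) ≠ 0 := by
        intro h
        have := hUγ m hm
        rw [h] at this
        norm_num at this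
        linarith
      rw [← ht]
      field_simp
    rw [hVU, aryOp_eq_sum hM hsM, ← ht]
    refine (abs_sum_sub_sum_le (y := V t / U t) (θ := (3 + 4 * C) * η) (E := N * D)
      ?_ ?_ ?_ ?_).trans (by push_cast; exact le_rfl)
    · rw [← Finset.sum_div, ht, ← aryOp_eq_sum hM hbM U, div_self hUpos.ne']
    · have := hs1 α
      rw [aryOp_eq_sum hM hsM] at this
      simpa [ht] using this
    · intro m hm
      exact abs_weight_sub_le (hbs _) (hsC _) (hUγ m hm) hUα hη
    · intro m hm
      refine (abs_sub_le_mul_of_abs_diff_le (f := fun γ => V γ / U γ) hD t m).trans ?_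
      have : (m : ℝ) ≤ N := by
        have : m ≤ N := by simp at hm; omega
        exact_mod_cast this
      exact mul_le_mul_of_nonneg_right this hD0
  -- Outside the window where `U` is controlled, both numerators vanish, and `0 / u = 0` for every
  -- `u`.
  · have hsup : M * ((H - 1) * N) + (M - 1) * N = (M * H - 1) * (N : ℤ) := by ring
    have h1 : aryOp M b V α = 0 := by
      by_contra h
      exact hα (hsup ▸ support_aryOp_subset hM hb hV h)
    have hq : support (fun γ => V γ / U γ) ⊆ Set.Icc 0 ((H - 1) * N) := fun x hx =>
      hV fun h => hx (by simp [h])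
    have h2 : aryOp M s (fun γ => V γ / U γ) α = 0 := by
      by_contra h
      exact hα (hsup ▸ support_aryOp_subset hM hs hq h)
    rw [h1, h2]
    simp only [zero_div, sub_zero, abs_zero]
    positivity

lemma aryOp_sub {M : ℤ} (hM : 0 < M) {N : ℕ} {s : ℤ → ℝ} (hs : support s ⊆ Set.Icc 0 (M * N))
    (f g : ℤ → ℝ) : aryOp M s (f - g) = aryOp M s f - aryOp M s g := by
  funext α
  simp only [Pi.sub_apply, aryOp_eq_sum hM hs, mul_sub, Finset.sum_sub_distrib]

lemma iterate_aryOp_sub {M : ℤ} (hM : 0 < M) {N : ℕ} {s : ℤ → ℝ}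
    (hs : support s ⊆ Set.Icc 0 (M * N)) (i : ℕ) (f g : ℤ → ℝ) :
    (aryOp M s)^[i] (f - g) = (aryOp M s)^[i] f - (aryOp M s)^[i] g := by
  induction i generalizing f g with
  | zero => rfl
  | succ i ih => rw [iterate_succ_apply, aryOp_sub hM hs, ih]; rfl

/-- Stability of a contractive constant-reproducing scheme with mask `s` under non-stationary
perturbations `b j`, as soon as the perturbed scheme has a solution `U` close to `1`. -/
lemma abs_sub_iterate_aryOp_le {M : ℤ} (hM : 0 < M) {N : ℕ} {s : ℤ → ℝ} {b U V : ℕ → ℤ → ℝ}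
    (hs : support s ⊆ Set.Icc 0 ((M - 1) * N))
    (hb : ∀ j, support (b j) ⊆ Set.Icc 0 ((M - 1) * N))
    (hs1 : ∀ α, aryOp M s (fun _ => 1) α = 1) {η C K : ℝ}
    (hK : K = (N + 1) * ((3 + 4 * C) * N)) (hKη : K * η ≤ 1 / 8) (hη : η ≤ 1 / 2)
    (hC : 1 ≤ C) (hbs : ∀ j τ, |b j τ - s τ| ≤ η)
    (hcontr : ∀ (f : ℤ → ℝ) (D : ℝ), (∀ α, |f (α + 1) - f α| ≤ D) →
      ∀ α, |aryOp M s f (α + 1) - aryOp M s f α| ≤ D / 4)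
    (hpow : ∀ (i : ℕ) (f : ℤ → ℝ) (B : ℝ), (∀ α, |f α| ≤ B) →
      ∀ α, |(aryOp M s)^[i] f α| ≤ C * B)
    (hV0 : V 0 = kron) (hV : ∀ j, V (j + 1) = aryOp M (b j) (V j))
    (hU : ∀ j, U (j + 1) = aryOp M (b j) (U j))
    (hU1 : ∀ j, ∀ γ : ℤ, -N ≤ γ → γ ≤ M ^ j * N → |U j γ - 1| ≤ η) (j : ℕ) (α : ℤ) :
    |V j α - (aryOp M s)^[j] kron α| ≤ (8 * K + 5) * C * η := by
  have hη0 : 0 ≤ η := (abs_nonneg _).trans (hbs 0 0)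
  have hK0 : 0 ≤ K := by rw [hK]; positivity
  have hsM := support_subset_mul hs
  have hsC : ∀ τ, |s τ| ≤ C := fun τ => by
    have := hpow 1 kron 1 (fun α => by
      by_cases h : α = 0 <;> simp [kron, h]) τ
    rwa [iterate_one, aryOp_kron, mul_one] at this
  have hVs : ∀ j, support (V j) ⊆ Set.Icc 0 ((M ^ j - 1) * N) := fun j => by
    induction j with
    | zero =>
      intro x hx
      have : x = 0 := by
        by_contra h
        exact hx (by simp [hV0, kron, h])
      simp [this]
    | succ j ih =>
      rw [hV]
      refine (support_aryOp_subset hM (hb j) ih).trans (Set.Icc_subset_Icc le_rfl (le_of_eq ?_))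
      ring
  set q : ℕ → ℤ → ℝ := fun j γ => V j γ / U j γ with hq
  have hstep : ∀ j D, (∀ α, |q j (α + 1) - q j α| ≤ D) →
      ∀ α, |q (j + 1) α - aryOp M s (q j) α| ≤ K * η * D := by
    intro j D hD α
    have h := abs_quotient_step_le (H := M ^ j) hM hs (hb j) hs1 hη (hbs j) hsC (hVs j) (hU1 j)
      (fun α h1 h2 => by
        rw [← hU j]
        refine hU1 (j + 1) α (by linarith [Int.natCast_nonneg N]) (h2.trans ?_)
        rw [pow_succ, mul_comm M]
        linarith [Int.natCast_nonneg N, sub_mul (M ^ j * M) 1 (N : ℤ)]) hD α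
    simp only [hq, hV, hU]
    refine h.trans (le_of_eq ?_)
    rw [hK]; ring
  have hq0 : ∀ α, |q 0 α| ≤ 2 := by
    intro α
    simp only [hq, hV0]
    by_cases h : α = 0
    · have h1 := hU1 0 0 (by simp) (by simp)
      have h2 : 1 / 2 ≤ U 0 0 := by linarith [(abs_le.1 h1).1]
      subst h
      rw [show kron 0 = 1 by simp [kron], abs_of_pos (by positivity),
        div_le_iff₀ (by linarith)]
      linarith
    · simp [kron, h]
  -- Initially `|q 0| ≤ 2`. Each step gives at most `1 / 4 + 2 * (1 / 8) = 1 / 2` of the previous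
  -- bound: contraction plus the perturbation at both neighbours.
  have hD : ∀ j α, |q j (α + 1) - q j α| ≤ 4 / 2 ^ j := by
    intro j
    induction j with
    | zero =>
      intro α
      have := (abs_sub (q 0 (α + 1)) (q 0 α)).trans (add_le_add (hq0 _) (hq0 _))
      norm_num at this ⊢
      exact this
    | succ j ih =>
      intro α
      have h1 := hstep j _ ih (α + 1)
      have h2 := hstep j _ ih α
      have h3 := hcontr _ _ ih α
      have h4 : K * η * (4 / 2 ^ j) ≤ 1 / 8 * (4 / 2 ^ j) :=
        mul_le_mul_of_nonneg_right hKη (by positivity)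
      have h5 : (4 : ℝ) / 2 ^ (j + 1) = (4 / 2 ^ j) / 2 := by rw [pow_succ]; field_simp
      rw [h5]
      rw [abs_le] at *
      constructor <;> linarith [h1.1, h1.2, h2.1, h2.2, h3.1, h3.2]
  -- Telescoping: the perturbation made at step `j` is propagated by later stationary steps at cost
  -- `C`, and the geometric bounds `4 / 2 ^ j` add up to `8`.
  have hE : ∀ j i α, |(aryOp M s)^[i] (q j) α - (aryOp M s)^[i + j] (q 0) α|
      ≤ C * (K * η) * (8 - 8 / 2 ^ j) := by
    intro j
    induction j with
    | zero => intro i α; simp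
    | succ j ih =>
      intro i α
      have h1 := ih (i + 1) α
      have h2 := hpow i (q (j + 1) - aryOp M s (q j)) _ (hstep j _ (hD j)) α
      rw [iterate_aryOp_sub hM hsM, Pi.sub_apply, ← iterate_succ_apply] at h2
      rw [show i + 1 + j = i + (j + 1) by ring] at h1
      have h5 : (8 : ℝ) / 2 ^ (j + 1) = 4 / 2 ^ j := by rw [pow_succ]; field_simp; norm_num
      have h6 : (8 : ℝ) / 2 ^ j = 2 * (4 / 2 ^ j) := by ring
      rw [h5]
      rw [h6] at h1
      refine (abs_sub_le _ _ _).trans ((add_le_add h2 h1).trans (le_of_eq ?_))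
      ring
  have h1 : |q j α - (aryOp M s)^[j] (q 0) α| ≤ C * (K * η) * 8 := by
    have h := hE j 0 α
    rw [zero_add, iterate_zero, id] at h
    refine h.trans (mul_le_mul_of_nonneg_left ?_ (by positivity))
    have : (0 : ℝ) ≤ 8 / 2 ^ j := by positivity
    linarith
  have h2 : |(aryOp M s)^[j] (q 0) α - (aryOp M s)^[j] kron α| ≤ C * (2 * η) := by
    have h := hpow j (q 0 - kron) (2 * η) (fun α => by
      simp only [hq, hV0, Pi.sub_apply]
      by_cases h : α = 0
      · have h1 := hU1 0 0 (by simp) (by simp)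
        have h2 : 1 / 2 ≤ U 0 0 := by linarith [(abs_le.1 h1).1]
        subst h
        rw [show kron 0 = 1 by simp [kron],
          show 1 / U 0 0 - 1 = -(U 0 0 - 1) / U 0 0 by field_simp [show U 0 0 ≠ 0 by linarith]; ring,
          abs_div, abs_neg, abs_of_pos (show 0 < U 0 0 by linarith), div_le_iff₀ (by linarith)]
        nlinarith
      · simp [kron, h, hη0]) α
    rwa [iterate_aryOp_sub hM hsM] at h
  have h3 : |q j α| ≤ 3 * C := by
    have h4 := hpow j (q 0) 2 hq0 α
    have h5 : C * (K * η) * 8 ≤ C := by nlinarith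
    rw [abs_le] at *
    constructor <;> linarith [h1.1, h1.2, h4.1, h4.2]
  have h4 : |V j α - q j α| ≤ 3 * C * η := by
    by_cases hα : V j α = 0
    · simp only [hq, hα, zero_div, sub_zero, abs_zero]; positivity
    · obtain ⟨h5, h6⟩ := hVs j hα
      have h7 := hU1 j α (by linarith [Int.natCast_nonneg N])
        (by linarith [Int.natCast_nonneg N, sub_mul (M ^ j) 1 (N : ℤ)])
      have h8 : U j α ≠ 0 := by
        have : 1 / 2 ≤ U j α := by linarith [(abs_le.1 h7).1]
        intro h; linarith
      have h9 : V j α - q j α = q j α * (U j α - 1) := by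
        simp only [hq]; field_simp
      rw [h9, abs_mul]
      exact mul_le_mul h3 h7 (abs_nonneg _) (by positivity)
  calc |V j α - (aryOp M s)^[j] kron α|
      ≤ |V j α - q j α| + |q j α - (aryOp M s)^[j] kron α| := abs_sub_le _ _ _
    _ ≤ |V j α - q j α| + (|q j α - (aryOp M s)^[j] (q 0) α|
          + |(aryOp M s)^[j] (q 0) α - (aryOp M s)^[j] kron α|) := by
        gcongr; exact abs_sub_le _ _ _
    _ ≤ 3 * C * η + (C * (K * η) * 8 + C * (2 * η)) := by gcongr
    _ = (8 * K + 5) * C * η := by ring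

/-! ### Stationary facts, and uniform convergence of the tail limit functions. -/

lemma masksIn_const {N : ℕ} {A : ℤ → ℝ} (hA : support A ⊆ Set.Icc (0 : ℤ) N) :
    MasksIn N (fun _ => A) := fun _ _ => hA

lemma support_subset_two_mul {N : ℕ} {A : ℤ → ℝ} (hA : support A ⊆ Set.Icc (0 : ℤ) N) :
    support A ⊆ Set.Icc 0 (2 * (N : ℤ)) :=
  hA.trans (Set.Icc_subset_Icc le_rfl (by omega))

lemma tendsto_add_const_div_two_pow {x : ℝ} {p : ℕ → ℤ}
    (hp : Tendsto (fun s => (p s : ℝ) / 2 ^ s) atTop (𝓝 x)) (e : ℤ) :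
    Tendsto (fun s => ((p s + e : ℤ) : ℝ) / 2 ^ s) atTop (𝓝 x) := by
  have h1 : Tendsto (fun s : ℕ => (e : ℝ) * (1 / 2 : ℝ) ^ s) atTop (𝓝 0) := by
    simpa using (tendsto_pow_atTop_nhds_zero_of_lt_one (r := (1 / 2 : ℝ)) (by norm_num)
      (by norm_num)).const_mul (e : ℝ)
  have h2 := hp.add h1
  rw [add_zero] at h2
  refine h2.congr fun s => ?_
  push_cast
  rw [add_div, div_pow, one_pow, mul_one_div]

/-- A stationary scheme with a nonzero limit function reproduces constants. -/
lemma aryOp_two_one_of_isLimit {N : ℕ} {A : ℤ → ℝ} (hA : support A ⊆ Set.Icc (0 : ℤ) N)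
    {φ : ℝ → ℝ} (hφ : Continuous φ) (hlim : IsLimit (fun _ => A) kron φ) {x : ℝ}
    (hx : φ x ≠ 0) (α : ℤ) : aryOp 2 A (fun _ => 1) α = 1 := by
  set s := refine (fun _ => A) kron with hs
  have hp := tendsto_floor_div_two_pow x
  -- The refined value at `2 * ⌊x * 2 ^ i⌋ + α` and all the coarse values entering it tend to `φ x`.
  -- Cancelling `φ x` leaves the sum of the weights.
  have h1 : Tendsto (fun i => s (i + 1) (2 * ⌊x * 2 ^ i⌋ + α)) atTop (𝓝 (φ x)) := by
    have h2 : Tendsto (fun i : ℕ => ((2 * ⌊x * 2 ^ (i - 1)⌋ : ℤ) : ℝ) / 2 ^ i) atTop (𝓝 x) := by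
      rw [← tendsto_add_atTop_iff_nat 1]
      refine hp.congr fun i => ?_
      simp only [Nat.add_sub_cancel]
      push_cast
      rw [pow_succ]
      field_simp
    exact (isLimit_tendsto hlim hφ.continuousAt (tendsto_add_const_div_two_pow h2 α)).comp
      (tendsto_add_atTop_nat 1)
  have h2 : Tendsto (fun i => s (i + 1) (2 * ⌊x * 2 ^ i⌋ + α)) atTop
      (𝓝 (∑ m ∈ Finset.range (N + 1), A (α - 2 * (α / 2 - m)) * φ x)) := by
    have h3 : Tendsto (fun i => ∑ m ∈ Finset.range (N + 1), A (α - 2 * (α / 2 - m)) *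
        s i (⌊x * 2 ^ i⌋ + (α / 2 - m))) atTop
        (𝓝 (∑ m ∈ Finset.range (N + 1), A (α - 2 * (α / 2 - m)) * φ x)) :=
      tendsto_finsetSum _ fun m _ => (isLimit_tendsto hlim hφ.continuousAt
        (tendsto_add_const_div_two_pow hp _)).const_mul _
    refine h3.congr fun i => ?_
    have h4 : s (i + 1) = aryOp 2 A (s i) := rfl
    rw [h4, aryOp_eq_sum (by norm_num) (support_subset_two_mul hA)]
    refine Finset.sum_congr rfl fun m _ => ?_
    have h5 : (2 * ⌊x * 2 ^ i⌋ + α) / 2 = ⌊x * 2 ^ i⌋ + α / 2 := by omega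
    rw [h5]
    congr 2 <;> ring
  have h3 := tendsto_nhds_unique h1 h2
  rw [← Finset.sum_mul] at h3
  rw [aryOp_eq_sum (by norm_num) (support_subset_two_mul hA)]
  simp only [mul_one]
  exact mul_right_cancel₀ hx (by rw [← h3, one_mul])

lemma refine_const_one {A : ℤ → ℝ} (h : ∀ α, aryOp 2 A (fun _ => 1) α = 1) (i : ℕ) :
    refine (fun _ => A) (fun _ => 1) i = fun _ => 1 := by
  induction i with
  | zero => rfl
  | succ i ih =>
    have h2 : refine (fun _ => A) (fun _ => 1) (i + 1)
      = aryOp 2 A (refine (fun _ => A) (fun _ => 1) i) := rfl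
    rw [h2, ih]
    exact funext h

lemma refine_eq_aryOp {N : ℕ} {A : ℤ → ℝ} (hA : support A ⊆ Set.Icc (0 : ℤ) N) (c : ℤ → ℝ)
    (i : ℕ) : refine (fun _ => A) c i = aryOp (2 ^ i) (refine (fun _ => A) kron i) c := by
  have := refine_add (masksIn_const hA) c 0 i
  rwa [zero_add] at this

lemma iterate_aryOp_refine {N : ℕ} {A : ℤ → ℝ} (hA : support A ⊆ Set.Icc (0 : ℤ) N) (n j : ℕ)
    (f : ℤ → ℝ) :
    (aryOp (2 ^ n) (refine (fun _ => A) kron n))^[j] f = refine (fun _ => A) f (n * j) := by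
  induction j with
  | zero => rfl
  | succ j ih =>
    rw [iterate_succ_apply', ih, mul_add, mul_one, refine_add (masksIn_const hA)]
    rfl

lemma hasCompactSupport_of_isLimit_kron {N : ℕ} {a : ℕ → ℤ → ℝ} (ha : MasksIn N a) {Φ : ℝ → ℝ}
    (hc : Continuous Φ) (h : IsLimit a kron Φ) : HasCompactSupport Φ :=
  HasCompactSupport.intro isCompact_Icc fun _ hx => isLimit_kron_eq_zero ha hc h hx

lemma eventually_abs_refine_kron_le {N : ℕ} {a : ℕ → ℤ → ℝ} (ha : MasksIn N a) {Φ : ℝ → ℝ}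
    (hc : Continuous Φ) (h : IsLimit a kron Φ) :
    ∃ C : ℝ, 1 ≤ C ∧ (∀ x, |Φ x| ≤ C) ∧ ∀ᶠ i : ℕ in atTop, ∀ α, |refine a kron i α| ≤ C := by
  obtain ⟨C, hC⟩ := hc.bounded_above_of_compact_support (hasCompactSupport_of_isLimit_kron ha hc h)
  have hC0 : 0 ≤ C := (norm_nonneg _).trans (hC 0)
  refine ⟨C + 1, by linarith, fun x => (hC x).trans (by linarith), ?_⟩
  filter_upwards [h 1 one_pos] with i hi α
  have h1 := hi α
  have h2 := hC ((α : ℝ) / 2 ^ i)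
  rw [Real.norm_eq_abs] at h2
  rw [abs_le] at *
  constructor <;> linarith [h1.1, h1.2, h2.1, h2.2]

lemma eventually_abs_diff_refine_kron_le {N : ℕ} {a : ℕ → ℤ → ℝ} (ha : MasksIn N a) {Φ : ℝ → ℝ}
    (hc : Continuous Φ) (h : IsLimit a kron Φ) {ω : ℝ} (hω : 0 < ω) :
    ∀ᶠ i : ℕ in atTop, ∀ α, |refine a kron i (α + 1) - refine a kron i α| ≤ ω := by
  have huc := 
    (hasCompactSupport_of_isLimit_kron ha hc h).uniformContinuous_of_continuous hc
  obtain ⟨δ, hδ, hδ'⟩ := Metric.uniformContinuous_iff.1 huc (ω / 3) (by positivity)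
  have h2 : ∀ᶠ i : ℕ in atTop, (1 / 2 : ℝ) ^ i < δ :=
    (tendsto_pow_atTop_nhds_zero_of_lt_one (r := (1 / 2 : ℝ)) (by norm_num)
      (by norm_num)).eventually (gt_mem_nhds hδ)
  filter_upwards [h (ω / 3) (by positivity), h2] with i hi h3 α
  have h4 := hδ' (a := ((α + 1 : ℤ) : ℝ) / 2 ^ i) (b := (α : ℝ) / 2 ^ i) (by
    rw [Real.dist_eq, ← sub_div]
    push_cast
    rw [add_sub_cancel_left, abs_of_pos (by positivity)]
    simpa using h3)
  rw [Real.dist_eq] at h4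
  have h5 := hi α
  have h6 := hi (α + 1)
  rw [abs_lt] at h4
  rw [abs_le] at *
  constructor <;> linarith [h4.1, h4.2, h5.1, h5.2, h6.1, h6.2]

lemma eventually_abs_refine_tail_sub_le {N : ℕ} {a : ℕ → ℤ → ℝ} (ha : MasksIn N a)
    {A : ℤ → ℝ} (hA : support A ⊆ Set.Icc (0 : ℤ) N)
    (hlim : ∀ α, Tendsto (fun k => a k α) atTop (𝓝 (A α))) (n : ℕ) {η : ℝ} (hη : 0 < η) :
    ∀ᶠ k : ℕ in atTop, ∀ τ,
      |refine (tailMasks k a) kron n τ - refine (fun _ => A) kron n τ| ≤ η := by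
  have hpt : ∀ n τ, Tendsto (fun k => refine (tailMasks k a) kron n τ) atTop
      (𝓝 (refine (fun _ => A) kron n τ)) := by
    intro n
    induction n with
    | zero => intro τ; exact tendsto_const_nhds
    | succ n ih =>
      intro τ
      have h1 : ∀ k, refine (tailMasks k a) kron (n + 1)
        = aryOp 2 (a (k + (n + 1))) (refine (tailMasks k a) kron n) := fun _ => rfl
      have h2 : refine (fun _ => A) kron (n + 1)
        = aryOp 2 A (refine (fun _ => A) kron n) := rfl
      simp only [h1, h2, aryOp_eq_sum (M := 2) (by norm_num) (support_subset_two_mul hA)]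
      have h3 : ∀ k f, aryOp 2 (a (k + (n + 1))) f τ = ∑ m ∈ Finset.range (N + 1),
          a (k + (n + 1)) (τ - 2 * (τ / 2 - m)) * f (τ / 2 - m) := fun k f =>
        aryOp_eq_sum (by norm_num) (support_subset_two_mul (ha _ (by omega))) f τ
      simp only [h3]
      exact tendsto_finsetSum _ fun m _ =>
        (((hlim _).comp (tendsto_add_atTop_nat (n + 1)))).mul (ih _)
  have h1 : ∀ᶠ k : ℕ in atTop, ∀ τ ∈ Finset.Icc (0 : ℤ) (2 ^ n * N),
      |refine (tailMasks k a) kron n τ - refine (fun _ => A) kron n τ| ≤ η := by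
    rw [Filter.eventually_all_finset]
    intro τ _
    have := (Metric.tendsto_nhds.1 (hpt n τ)) η hη
    filter_upwards [this] with k hk
    rw [Real.dist_eq] at hk
    exact hk.le
  filter_upwards [h1] with k hk τ
  by_cases hτ : τ ∈ Finset.Icc (0 : ℤ) (2 ^ n * N)
  · exact hk τ hτ
  · rw [Finset.mem_Icc] at hτ
    have h2 : refine (tailMasks k a) kron n τ = 0 := by
      by_contra h
      exact hτ (support_refine_kron' (ha.tail k) n h)
    have h3 : refine (fun _ => A) kron n τ = 0 := by
      by_contra h
      exact hτ (support_refine_kron' (masksIn_const hA) n h)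
    simp [h2, h3, hη.le]

/-- Near a point where a limit function does not vanish, the normalised data are close to `1`. -/
lemma eventually_exists_abs_refine_div_sub_one_le {a : ℕ → ℤ → ℝ} {c : ℤ → ℝ} {g : ℝ → ℝ}
    (hg : Continuous g) (hlim : IsLimit a c g) {x : ℝ} (hx : g x ≠ 0) (N : ℕ) {η : ℝ}
    (hη : 0 < η) :
    ∀ᶠ k : ℕ in atTop, ∃ β : ℤ, ∀ (i : ℕ) (γ : ℤ), -N ≤ γ → γ ≤ 2 ^ i * N →
      |refine a c (k + i) (γ + 2 ^ i * β) / g x - 1| ≤ η := by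
  have hgx : 0 < |g x| := abs_pos.2 hx
  obtain ⟨r, hr, hr'⟩ := Metric.continuous_iff.1 hg x (η * |g x| / 2) (by positivity)
  have h1 : ∀ᶠ k : ℕ in atTop, ((N : ℝ) + 1) * (1 / 2 : ℝ) ^ k < r := by
    have := (tendsto_pow_atTop_nhds_zero_of_lt_one (r := (1 / 2 : ℝ)) (by norm_num)
      (by norm_num)).const_mul ((N : ℝ) + 1)
    rw [mul_zero] at this
    exact this.eventually (gt_mem_nhds hr)
  filter_upwards [h1, eventually_forall_ge_atTop.2 (hlim (η * |g x| / 2) (by positivity))] with k h2 h3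
  -- For every `i`, the window rescaled by `2 ^ (k + i)` lies within `(N + 1) / 2 ^ k` of `x`; this
  -- makes the estimate uniform in `i`.
  refine ⟨⌊x * 2 ^ k⌋, fun i γ h4 h5 => ?_⟩
  set p := γ + 2 ^ i * ⌊x * 2 ^ k⌋ with hp
  have h6 : |g ((p : ℝ) / 2 ^ (k + i)) - g x| ≤ η * |g x| / 2 := by
    refine (hr' _ ?_).le
    have e1 : (p : ℝ) / 2 ^ (k + i) - x
        = (γ : ℝ) / 2 ^ i * (1 / 2) ^ k + (⌊x * 2 ^ k⌋ - x * 2 ^ k) * (1 / 2) ^ k := by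
      rw [hp, pow_add, one_div_pow]
      push_cast
      field_simp
      ring
    have e2 : |(γ : ℝ) / 2 ^ i| ≤ N := by
      rw [abs_div, abs_of_pos (show (0 : ℝ) < 2 ^ i by positivity), div_le_iff₀ (by positivity),
        abs_le]
      have h4' : -(N : ℝ) ≤ γ := by exact_mod_cast h4
      have h5' : (γ : ℝ) ≤ 2 ^ i * N := by exact_mod_cast h5
      have h7 : (N : ℝ) ≤ N * 2 ^ i := le_mul_of_one_le_right (by positivity)
        (one_le_pow₀ (by norm_num))
      constructor <;> linarith
    have e3 : |(⌊x * 2 ^ k⌋ : ℝ) - x * 2 ^ k| ≤ 1 := by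
      have h7 := Int.floor_le (x * 2 ^ k)
      have h8 := Int.lt_floor_add_one (x * 2 ^ k)
      rw [abs_le]
      constructor <;> linarith
    rw [Real.dist_eq, e1, ← add_mul, abs_mul, abs_of_pos (show (0 : ℝ) < (1 / 2) ^ k by positivity)]
    refine lt_of_le_of_lt (mul_le_mul_of_nonneg_right ?_ (by positivity)) h2
    exact (abs_add_le _ _).trans (add_le_add e2 e3)
  have h7 := h3 (k + i) (by omega) p
  have h8 : refine a c (k + i) p / g x - 1 = (refine a c (k + i) p - g x) / g x := by
    field_simp
  rw [h8, abs_div, div_le_iff₀ hgx]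
  rw [abs_le] at *
  constructor <;> linarith [h6.1, h6.2, h7.1, h7.2]

/-- If the masks converge to the mask of a stationary scheme with limit function `φ`, and the
non-stationary scheme has some nonvanishing continuous limit, then the basic limit functions of
its tails converge uniformly to `φ`. -/
theorem eventually_abs_limit_tail_sub_le {N : ℕ} {a : ℕ → ℤ → ℝ} (ha : MasksIn N a)
    {A : ℤ → ℝ} (hA : support A ⊆ Set.Icc (0 : ℤ) N)
    (hlim : ∀ α, Tendsto (fun k => a k α) atTop (𝓝 (A α)))
    {φ : ℝ → ℝ} (hφ : Continuous φ) (hφl : IsLimit (fun _ => A) kron φ) (hφ0 : ∃ x, φ x ≠ 0)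
    {c : ℤ → ℝ} {g : ℝ → ℝ} (hg : Continuous g) (hgl : IsLimit a c g) (hg0 : ∃ x, g x ≠ 0)
    {Φ : ℕ → ℝ → ℝ} (hΦ : ∀ k, Continuous (Φ k)) (hΦl : ∀ k, IsLimit (tailMasks k a) kron (Φ k))
    {ε : ℝ} (hε : 0 < ε) :
    ∀ᶠ k : ℕ in atTop, ∀ x, |Φ k x - φ x| ≤ ε := by
  obtain ⟨x₁, hx₁⟩ := hφ0
  obtain ⟨x₀, hx₀⟩ := hg0
  have hAm := masksIn_const hA
  have hA1 := aryOp_two_one_of_isLimit hA hφ hφl hx₁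
  obtain ⟨C₀, hC₀, hφC, hsC⟩ := eventually_abs_refine_kron_le hAm hφ hφl
  -- Each output value involves at most `N + 1` mask entries, so `C` bounds all powers of the
  -- blocked stationary operator.
  set C : ℝ := (N + 1) * C₀ with hC
  have hC1 : 1 ≤ C := by nlinarith [Nat.cast_nonneg (α := ℝ) N]
  set K : ℝ := (N + 1) * ((3 + 4 * C) * N) with hK
  have hK0 : 0 ≤ K := by positivity
  obtain ⟨η, hη0, hη2, hηK, hηε⟩ : ∃ η : ℝ, 0 < η ∧ η ≤ 1 / 2 ∧ K * η ≤ 1 / 8 ∧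
      (8 * K + 5) * C * η ≤ ε := by
    refine ⟨min (1 / 2) (min (1 / (8 * (K + 1))) (ε / ((8 * K + 5) * C))), by positivity,
      min_le_left _ _, ?_, ?_⟩
    · have h1 : min (1 / 2) (min (1 / (8 * (K + 1))) (ε / ((8 * K + 5) * C))) ≤ 1 / (8 * (K + 1)) :=
        (min_le_right _ _).trans (min_le_left _ _)
      refine (mul_le_mul_of_nonneg_left h1 hK0).trans ?_
      rw [mul_one_div, div_le_div_iff₀ (by positivity) (by norm_num)]
      linarith
    · have h1 : min (1 / 2) (min (1 / (8 * (K + 1))) (ε / ((8 * K + 5) * C)))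
          ≤ ε / ((8 * K + 5) * C) := (min_le_right _ _).trans (min_le_right _ _)
      refine (mul_le_mul_of_nonneg_left h1 (by positivity)).trans (le_of_eq ?_)
      field_simp
  -- Chosen to make the contraction factor `(N + 2) * (N + 1) * ω` equal to `1 / 4`.
  set ω : ℝ := 1 / (4 * ((N + 2) * (N + 1))) with hω
  obtain ⟨n, hn1, hnC, hnω⟩ : ∃ n : ℕ, 1 ≤ n ∧
      (∀ i, n ≤ i → ∀ α, |refine (fun _ => A) kron i α| ≤ C₀) ∧
      ∀ α, |refine (fun _ => A) kron n (α + 1) - refine (fun _ => A) kron n α| ≤ ω :=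
    ((eventually_ge_atTop 1).and ((eventually_forall_ge_atTop.2 hsC).and
      (eventually_abs_diff_refine_kron_le hAm hφ hφl (show 0 < ω by positivity)))).exists
  set s := refine (fun _ => A) kron n with hs
  have hM : (0 : ℤ) < 2 ^ n := by positivity
  have hsupp : support s ⊆ Set.Icc (0 : ℤ) ((2 ^ n - 1) * N) := support_refine_kron hAm n
  have hs1 : ∀ α, aryOp (2 ^ n) s (fun _ => 1) α = 1 := fun α => by
    rw [hs, ← refine_eq_aryOp hA, refine_const_one hA1]
  have hcontr : ∀ (f : ℤ → ℝ) (D : ℝ), (∀ α, |f (α + 1) - f α| ≤ D) →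
      ∀ α, |aryOp (2 ^ n) s f (α + 1) - aryOp (2 ^ n) s f α| ≤ D / 4 := by
    intro f D hD α
    refine (abs_aryOp_sub_le_of_diff hM (support_subset_mul hsupp) hs1 hnω hD α).trans
      (le_of_eq ?_)
    rw [hω]
    field_simp
  have hpow : ∀ (i : ℕ) (f : ℤ → ℝ) (B : ℝ), (∀ α, |f α| ≤ B) →
      ∀ α, |(aryOp (2 ^ n) s)^[i] f α| ≤ C * B := by
    intro i f B hf α
    have hB0 : 0 ≤ B := (abs_nonneg _).trans (hf 0)
    rcases Nat.eq_zero_or_pos i with rfl | hi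
    · exact (hf α).trans (le_mul_of_one_le_left hB0 hC1)
    · rw [iterate_aryOp_refine hA, refine_eq_aryOp hA,
        aryOp_eq_sum (N := N) (by positivity) (support_refine_kron' hAm _)]
      refine (Finset.abs_sum_le_sum_abs _ _).trans
        ((Finset.sum_le_card_nsmul _ _ (C₀ * B) fun m _ => ?_).trans ?_)
      · rw [abs_mul]
        exact mul_le_mul (hnC _ (Nat.le_mul_of_pos_right n hi) _) (hf _) (abs_nonneg _)
          (by positivity)
      · rw [Finset.card_range, nsmul_eq_mul, hC]
        push_cast
        linarith
  filter_upwards [eventually_exists_abs_refine_div_sub_one_le hg hgl hx₀ N hη0,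
    eventually_forall_ge_atTop.2 (eventually_abs_refine_tail_sub_le ha hA hlim n hη0)] with k ⟨β, hβ⟩ hk x
  have hdisc : ∀ (j : ℕ) (α : ℤ), |refine (tailMasks k a) kron (n * j) α
      - refine (fun _ => A) kron (n * j) α| ≤ ε := by
    intro j α
    have h := abs_sub_iterate_aryOp_le hM (N := N) (s := s)
      (b := fun j => refine (tailMasks (k + n * j) a) kron n)
      -- The reference data are recentred: a shift by `β` at level `k` becomes `2 ^ (n * j) * β`
      -- after `n * j` more steps.
      (U := fun j γ => refine a c (k + n * j) (γ + 2 ^ (n * j) * β) / g x₀)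
      (V := fun j => refine (tailMasks k a) kron (n * j))
      hsupp (fun j => support_refine_kron (ha.tail _) n) hs1 hK hηK hη2 hC1
      (fun j τ => hk (k + n * j) (by omega) τ) hcontr hpow rfl
      (fun j => by
        rw [mul_add, mul_one, refine_add (ha.tail k), tailMasks_tailMasks])
      (fun j => by
        funext γ
        have hb := support_subset_mul (support_refine_kron (ha.tail (k + n * j)) n)
        have e1 : k + n * (j + 1) = (k + n * j) + n := by ring
        have e2 : γ + 2 ^ (n * (j + 1)) * β = γ + 2 ^ n * (2 ^ (n * j) * β) := by
          rw [mul_add, pow_add]; ring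
        rw [e1, refine_add ha, e2, aryOp_eq_sum hM hb, aryOp_eq_sum hM hb, Finset.sum_div,
          Int.add_mul_ediv_left _ _ hM.ne']
        refine Finset.sum_congr rfl fun m _ => ?_
        rw [mul_div_assoc]
        congr 2
        · ring
        · congr 1; ring)
      (fun j γ h1 h2 => hβ _ γ h1 (by rwa [pow_mul])) j α
    rw [iterate_aryOp_refine hA] at h
    exact h.trans hηε
  -- Both limits exist already, so comparing them along multiples of the block length suffices.
  have ht : Tendsto (fun j => n * j) atTop atTop := tendsto_id.const_mul_atTop' hn1
  have h1 := (isLimit_tendsto_floor (hΦl k) (hΦ k) x).comp ht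
  have h2 := (isLimit_tendsto_floor hφl hφ x).comp ht
  exact le_of_tendsto (h1.sub h2).abs (Eventually.of_forall fun j => hdisc j _)

/-! ### Alternating sums of samples of smooth functions. -/

/-- The alternating sum of the samples `f (x + hβ)`. -/
noncomputable def altSum (h : ℝ) (f : ℝ → ℝ) (x : ℝ) : ℝ := ∑ᶠ β : ℤ, (-1 : ℝ) ^ β * f (x + h * β)

lemma altSum_add_step (h : ℝ) (f : ℝ → ℝ) (x : ℝ) : altSum h f (x + h) = -altSum h f x := by
  rw [altSum, altSum, ← finsum_comp_equiv (Equiv.addRight (1 : ℤ)) (f := fun β : ℤ =>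
    (-1 : ℝ) ^ β * f (x + h * β)), ← finsum_neg_distrib]
  refine finsum_congr fun β => ?_
  simp only [Equiv.coe_addRight, zpow_add₀ (show (-1 : ℝ) ≠ 0 by norm_num)]
  push_cast
  rw [show x + h * ((β : ℝ) + 1) = x + h + h * β by ring]
  simp

/-- A finite set of indices covering the samples `x + hβ` in `[lo, hi]` for `x ∈ [x₀, x₀ + h]`. -/
lemma exists_finset_altSum {h : ℝ} (hh : 0 < h) {lo hi : ℝ} (hlh : lo ≤ hi) (x₀ : ℝ) :
    ∃ F : Finset ℤ, (F.card : ℝ) ≤ (hi - lo) / h + 4 ∧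
      ∀ f : ℝ → ℝ, (∀ x, x ∉ Set.Icc lo hi → f x = 0) → ∀ x ∈ Set.Icc x₀ (x₀ + h),
        altSum h f x = ∑ β ∈ F, (-1 : ℝ) ^ β * f (x + h * β) := by
  -- The `- 1` accommodates base points up to `x₀ + h`. One index set for the whole interval allows
  -- subtracting and differentiating the sum termwise.
  refine ⟨Finset.Icc ⌊(lo - x₀) / h - 1⌋ ⌈(hi - x₀) / h⌉, ?_, fun f hf x hx => ?_⟩
  · have h1 := Int.lt_floor_add_one ((lo - x₀) / h - 1)
    have h2 := Int.ceil_lt_add_one ((hi - x₀) / h)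
    have h3 : (lo - x₀) / h ≤ (hi - x₀) / h := by gcongr
    have h4 : (0 : ℤ) ≤ ⌈(hi - x₀) / h⌉ + 1 - ⌊(lo - x₀) / h - 1⌋ := by
      have h5 := Int.le_ceil ((hi - x₀) / h)
      have h6 := Int.floor_le ((lo - x₀) / h - 1)
      have : (⌊(lo - x₀) / h - 1⌋ : ℝ) ≤ ⌈(hi - x₀) / h⌉ := by linarith
      have : ⌊(lo - x₀) / h - 1⌋ ≤ ⌈(hi - x₀) / h⌉ := by exact_mod_cast this
      linarith
    rw [Int.card_Icc]
    have h5 : (((⌈(hi - x₀) / h⌉ + 1 - ⌊(lo - x₀) / h - 1⌋).toNat : ℤ) : ℝ)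
      = ((⌈(hi - x₀) / h⌉ + 1 - ⌊(lo - x₀) / h - 1⌋ : ℤ) : ℝ) := by rw [Int.toNat_of_nonneg h4]
    have h6 : (hi - lo) / h = (hi - x₀) / h - (lo - x₀) / h := by ring
    rw [h6]
    rw [Int.cast_natCast] at h5
    rw [h5]
    push_cast
    linarith
  · refine finsum_eq_sum_of_support_subset _ fun β hβ => ?_
    have h1 : x + h * β ∈ Set.Icc lo hi := by
      by_contra hn
      exact hβ (by simp [hf _ hn])
    obtain ⟨h2, h3⟩ := h1
    obtain ⟨h4, h5⟩ := hx
    rw [Finset.coe_Icc]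
    constructor
    · rw [Int.floor_le_iff, sub_lt_iff_lt_add, div_lt_iff₀ hh]
      linarith
    · refine Int.le_ceil_iff.2 ?_
      rw [lt_div_iff₀ hh]
      linarith

/-- A shift by `h` changes the sign, so twice the sum is a sum of increments of `f` over distance
`h`. Each is uniformly small, and there are `O(1 / h)` of them. -/
lemma exists_mul_abs_altSum_le_of_continuous {f : ℝ → ℝ} (hf : Continuous f) {lo hi : ℝ}
    (hlh : lo ≤ hi) (h0 : ∀ x, x ∉ Set.Icc lo hi → f x = 0) {ε : ℝ} (hε : 0 < ε) :
    ∃ h₀ > 0, ∀ h, 0 < h → h < h₀ → ∀ x, h * |altSum h f x| ≤ ε := by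
  have huc := (HasCompactSupport.intro isCompact_Icc h0).uniformContinuous_of_continuous hf
  have hB : 0 < hi - lo + 4 := by linarith
  obtain ⟨δ, hδ, hδ'⟩ := Metric.uniformContinuous_iff.1 huc (ε / (hi - lo + 4)) (by positivity)
  refine ⟨min δ 1, by positivity, fun h hh hlt x => ?_⟩
  obtain ⟨F, hF, hF'⟩ := exists_finset_altSum hh hlh x
  have h1 : 2 * altSum h f x = ∑ β ∈ F, (-1 : ℝ) ^ β * (f (x + h * β) - f (x + h + h * β)) := by
    have h2 : 2 * altSum h f x = altSum h f x - altSum h f (x + h) := by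
      rw [altSum_add_step]; ring
    rw [h2, hF' f h0 x (by simp [hh.le]), hF' f h0 (x + h) (by simp [hh.le]),
      ← Finset.sum_sub_distrib]
    simp only [mul_sub]
  have h2 : |2 * altSum h f x| ≤ F.card * (ε / (hi - lo + 4)) := by
    rw [h1]
    refine (Finset.abs_sum_le_sum_abs _ _).trans ((Finset.sum_le_card_nsmul _ _
      (ε / (hi - lo + 4)) fun β _ => ?_).trans (by simp))
    rw [abs_mul, abs_zpow]
    simp only [abs_neg, abs_one, one_zpow, one_mul]
    refine (hδ' ?_).le
    rw [Real.dist_eq, show x + h * β - (x + h + h * β) = -h by ring, abs_neg, abs_of_pos hh]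
    exact hlt.trans_le (min_le_left _ _)
  rw [abs_mul, abs_two] at h2
  have h3 : h * F.card ≤ hi - lo + 4 := by
    have h4 := mul_le_mul_of_nonneg_left hF hh.le
    rw [mul_add, mul_div_cancel₀ _ hh.ne'] at h4
    linarith [hlt.trans_le (min_le_right δ 1)]
  have h4 : h * (2 * |altSum h f x|) ≤ ε := by
    calc h * (2 * |altSum h f x|) ≤ h * (F.card * (ε / (hi - lo + 4))) := by gcongr
      _ = (h * F.card) * (ε / (hi - lo + 4)) := by ring
      _ ≤ (hi - lo + 4) * (ε / (hi - lo + 4)) := by gcongr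
      _ = ε := by field_simp
  linarith [mul_nonneg hh.le (abs_nonneg (altSum h f x))]

/-- Alternating sums of samples of a compactly supported `C^ℓ` function are `o(h^(ℓ-1))`. -/
lemma exists_mul_abs_altSum_le {ℓ : ℕ} {f : ℝ → ℝ} (hf : ContDiff ℝ ℓ f) {lo hi : ℝ}
    (hlh : lo ≤ hi) (h0 : ∀ x, x ∉ Set.Icc lo hi → f x = 0) {ε : ℝ} (hε : 0 < ε) :
    ∃ h₀ > 0, ∀ h, 0 < h → h < h₀ → ∀ x, h * |altSum h f x| ≤ ε * h ^ ℓ := by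
  induction ℓ generalizing f with
  | zero => simpa using exists_mul_abs_altSum_le_of_continuous hf.continuous hlh h0 hε
  | succ ℓ ih =>
    have hf' : ContDiff ℝ ((ℓ : WithTop ℕ∞) + 1) f := by exact_mod_cast hf
    obtain ⟨hd, -, hd'⟩ := contDiff_succ_iff_deriv.1 hf'
    have h0' : ∀ x, x ∉ Set.Icc lo hi → deriv f x = 0 := by
      intro x hx
      have : f =ᶠ[𝓝 x] fun _ => 0 := by
        filter_upwards [isClosed_Icc.isOpen_compl.mem_nhds (Set.mem_compl hx)] with y hy
        exact h0 y hy
      rw [this.deriv_eq]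
      simp
    obtain ⟨h₀, hpos, hh₀⟩ := ih hd' h0'
    refine ⟨h₀, hpos, fun h hh hlt x => ?_⟩
    obtain ⟨F, -, hF⟩ := exists_finset_altSum hh hlh x
    -- By the sign change, the increment over `[x, x + h]` is minus twice the sum. The mean value
    -- inequality bounds it by `h` times the alternating sum of `deriv f`, gaining one power of `h`.
    have hmv := norm_image_sub_le_of_norm_deriv_le_segment'
      (f := fun t => ∑ β ∈ F, (-1 : ℝ) ^ β * f (t + h * β))
      (f' := fun t => ∑ β ∈ F, (-1 : ℝ) ^ β * deriv f (t + h * β)) (a := x) (b := x + h)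
      (C := ε * h ^ ℓ / h) (fun t _ => by
        apply HasDerivAt.hasDerivWithinAt
        exact HasDerivAt.fun_sum fun β _ =>
          (((hd (t + h * β)).hasDerivAt).comp_add_const t (h * β)).const_mul _)
      (fun t ht => by
        rw [← hF _ h0' t ⟨ht.1, ht.2.le⟩, Real.norm_eq_abs, le_div_iff₀ hh, mul_comm]
        exact hh₀ h hh hlt t) (x + h) (by simp [hh.le])
    rw [← hF f h0 _ (by simp [hh.le]), ← hF f h0 _ (by simp [hh.le]), altSum_add_step,
      Real.norm_eq_abs, show -altSum h f x - altSum h f x = -(2 * altSum h f x) by ring, abs_neg,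
      abs_mul, abs_two, add_sub_cancel_left, div_mul_cancel₀ _ hh.ne'] at hmv
    have h3 : h * (2 * |altSum h f x|) ≤ h * (ε * h ^ ℓ) := mul_le_mul_of_nonneg_left hmv hh.le
    rw [pow_succ]
    linarith [mul_nonneg hh.le (abs_nonneg (altSum h f x))]

/-! ### Alternating moments and inversion of binomial convolutions. -/

/-- Alternating moments about `-y`. -/
noncomputable def altMoment (y : ℝ) (j : ℕ) (F : ℤ → ℝ) : ℝ :=
  ∑ᶠ β : ℤ, (-1 : ℝ) ^ β * (y + β) ^ j * F β

/-- Alternating moments of a subdivided sequence, by the binomial theorem. -/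
lemma altMoment_aryOp (M : ℤ) (y : ℝ) (j : ℕ) {F G : ℤ → ℝ} (hF : (support F).Finite)
    (hG : (support G).Finite) :
    altMoment y j (aryOp M F G) = ∑ p ∈ Finset.HasAntidiagonal.antidiagonal j, (j.choose p.1 : ℝ) *
      ((∑ᶠ γ : ℤ, (-1 : ℝ) ^ (M * γ) * ((M : ℝ) * γ) ^ p.1 * G γ) * altMoment y p.2 F) := by
  have hsF : ∀ w : ℤ → ℝ, ∑ᶠ τ, w τ * F τ = ∑ τ ∈ hF.toFinset, w τ * F τ := fun w =>
    finsum_eq_sum_of_support_subset _ fun τ hτ => by simpa using right_ne_zero_of_mul hτ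
  have hsG : ∀ w : ℤ → ℝ, ∑ᶠ τ, w τ * G τ = ∑ τ ∈ hG.toFinset, w τ * G τ := fun w =>
    finsum_eq_sum_of_support_subset _ fun τ hτ => by simpa using right_ne_zero_of_mul hτ
  simp only [altMoment]
  rw [finsum_mul_aryOp (w := fun β : ℤ => (-1 : ℝ) ^ β * (y + β) ^ j)
    (finite_support_of_right (w := fun β : ℤ => (-1 : ℝ) ^ β * (y + β) ^ j) hF hG)]
  simp only [hsF, hsG]
  have h1 : ∀ p ∈ Finset.HasAntidiagonal.antidiagonal j, (j.choose p.1 : ℝ) *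
      ((∑ γ ∈ hG.toFinset, (-1 : ℝ) ^ (M * γ) * ((M : ℝ) * γ) ^ p.1 * G γ) *
        ∑ τ ∈ hF.toFinset, (-1 : ℝ) ^ τ * (y + τ) ^ p.2 * F τ)
      = ∑ γ ∈ hG.toFinset, ∑ τ ∈ hF.toFinset, (j.choose p.1 : ℝ) *
        (((-1 : ℝ) ^ (M * γ) * ((M : ℝ) * γ) ^ p.1 * G γ) *
          ((-1 : ℝ) ^ τ * (y + τ) ^ p.2 * F τ)) := by
    intro p _
    rw [Finset.sum_mul_sum, Finset.mul_sum]
    simp only [Finset.mul_sum]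
  rw [Finset.sum_congr rfl h1, Finset.sum_comm]
  refine Finset.sum_congr rfl fun γ _ => ?_
  rw [Finset.sum_comm, Finset.sum_mul]
  refine Finset.sum_congr rfl fun τ _ => ?_
  rw [zpow_add₀ (show (-1 : ℝ) ≠ 0 by norm_num)]
  push_cast
  rw [show y + ((τ : ℝ) + M * γ) = M * γ + (y + τ) by ring, (Commute.all _ _).add_pow',
    Finset.mul_sum, Finset.sum_mul, Finset.sum_mul]
  refine Finset.sum_congr rfl fun p _ => ?_
  rw [nsmul_eq_mul]
  ring

/-- Binomial convolution with a bounded sequence with nondegenerate constant term can be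
inverted. -/
lemma tendsto_zero_of_binomial_convolution {ℓ : ℕ} {Y Z : ℕ → ℕ → ℝ}
    (hZ : ∀ i, ∃ B, ∀ᶠ k in atTop, |Z k i| ≤ B) {c : ℝ} (hc : 0 < c)
    (hZ0 : ∀ᶠ k in atTop, c ≤ |Z k 0|)
    (hsum : ∀ j, j ≤ ℓ → Tendsto (fun k => ∑ p ∈ Finset.HasAntidiagonal.antidiagonal j,
      (j.choose p.1 : ℝ) * (Y k p.1 * Z k p.2)) atTop (𝓝 0)) (j : ℕ) (hj : j ≤ ℓ) :
    Tendsto (fun k => Y k j) atTop (𝓝 0) := by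
  induction j using Nat.strong_induction_on with
  | _ j ih =>
    have h1 : Tendsto (fun k => ∑ i ∈ Finset.range j,
        (j.choose i : ℝ) * (Y k i * Z k (j - i))) atTop (𝓝 0) := by
      rw [← Finset.sum_const_zero (s := Finset.range j)]
      refine tendsto_finsetSum _ fun i hi => ?_
      have hi' : i < j := Finset.mem_range.1 hi
      obtain ⟨B, hB⟩ := hZ (j - i)
      have h2 : Tendsto (fun k => |Y k i| * B) atTop (𝓝 0) := by
        simpa using (ih i hi' (by omega)).abs.mul_const B
      have h3 : Tendsto (fun k => Y k i * Z k (j - i)) atTop (𝓝 0) := by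
        refine squeeze_zero_norm' ?_ h2
        filter_upwards [hB] with k hk
        rw [Real.norm_eq_abs, abs_mul]
        gcongr
      simpa using h3.const_mul (j.choose i : ℝ)
    -- By induction the terms with `i < j` vanish in the limit, leaving only the diagonal one.
    have h2 : Tendsto (fun k => Y k j * Z k 0) atTop (𝓝 0) := by
      have := (hsum j hj).sub h1
      rw [sub_zero] at this
      refine this.congr fun k => ?_
      rw [Finset.Nat.sum_antidiagonal_eq_sum_range_succ_mk, Finset.sum_range_succ]
      simp
    have h3 : Tendsto (fun k => |Y k j * Z k 0| / c) atTop (𝓝 0) := by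
      simpa using h2.abs.div_const c
    refine squeeze_zero_norm' ?_ h3
    filter_upwards [hZ0] with k hk
    rw [Real.norm_eq_abs, le_div_iff₀ hc, abs_mul]
    gcongr

/-! ### Ordinary moments of the refined data. -/

lemma sum_range_two_mul (f : ℕ → ℝ) (n : ℕ) : ∑ i ∈ Finset.range (2 * n), f i
    = ∑ m ∈ Finset.range n, f (2 * m) + ∑ m ∈ Finset.range n, f (2 * m + 1) := by
  induction n with
  | zero => simp
  | succ n ih =>
    rw [show 2 * (n + 1) = 2 * n + 1 + 1 by ring, Finset.sum_range_succ, Finset.sum_range_succ, ih,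
      Finset.sum_range_succ _ n, Finset.sum_range_succ _ n]
    ring

lemma finsum_eq_sum_range {f : ℤ → ℝ} {L : ℕ} (hf : support f ⊆ Set.Ico (0 : ℤ) L) :
    ∑ᶠ τ, f τ = ∑ n ∈ Finset.range L, f n := by
  rw [finsum_eq_sum_of_support_subset (s := (Finset.range L).image fun n : ℕ => (n : ℤ)),
    Finset.sum_image (by intro x _ y _ h; simpa using h)]
  intro τ hτ
  obtain ⟨h1, h2⟩ := hf hτ
  simp only [Finset.coe_image, Finset.coe_range, Set.mem_image, Set.mem_Iio]
  exact ⟨τ.toNat, by omega, by omega⟩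

/-- Reproduction of constants at `0` and at `1` says that the even and the odd entries each sum to
`1`. -/
lemma finsum_mask_eq_two {N : ℕ} {A : ℤ → ℝ} (hA : support A ⊆ Set.Icc (0 : ℤ) N)
    (h : ∀ α, aryOp 2 A (fun _ => 1) α = 1) : ∑ᶠ τ, A τ = 2 := by
  have h0 := h 0
  have h1 := h 1
  rw [aryOp_eq_sum (by norm_num) (support_subset_two_mul hA)] at h0 h1
  rw [finsum_eq_sum_range (L := 2 * (N + 1)), sum_range_two_mul (fun n => A n)]
  · have e0 : ∑ m ∈ Finset.range (N + 1), A ((2 * m : ℕ) : ℤ) = 1 := by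
      rw [← h0]
      refine Finset.sum_congr rfl fun m _ => ?_
      rw [mul_one]; congr 1; push_cast; norm_num
    have e1 : ∑ m ∈ Finset.range (N + 1), A ((2 * m + 1 : ℕ) : ℤ) = 1 := by
      rw [← h1]
      refine Finset.sum_congr rfl fun m _ => ?_
      rw [mul_one]; congr 1; push_cast; norm_num; ring
    rw [e0, e1]; norm_num
  · intro τ hτ
    obtain ⟨h2, h3⟩ := hA hτ
    exact ⟨h2, by push_cast; omega⟩

lemma finsum_refine_kron {N : ℕ} {A : ℤ → ℝ} (hA : support A ⊆ Set.Icc (0 : ℤ) N)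
    (h : ∀ α, aryOp 2 A (fun _ => 1) α = 1) (m : ℕ) :
    ∑ᶠ γ, refine (fun _ => A) kron m γ = 2 ^ m := by
  induction m with
  | zero =>
    rw [finsum_eq_single _ 0]
    · simp [refine, kron]
    · intro x hx; simp [refine, kron, hx]
  | succ m ih =>
    have h2 : refine (fun _ => A) kron (m + 1) = aryOp 2 A (refine (fun _ => A) kron m) := rfl
    have h3 := finsum_mul_aryOp (M := 2) (w := fun _ => 1) (b := A)
      (f := refine (fun _ => A) kron m) (finite_support_of_right (w := fun _ => 1)
        (finite_support_of_subset_Icc hA) (finite_support_refine_kron (masksIn_const hA) m))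
    simp only [one_mul, finsum_mask_eq_two hA h] at h3
    rw [h2, h3, ← mul_finsum, ih, pow_succ, mul_comm]

lemma abs_finsum_le {f : ℤ → ℝ} {n : ℕ} {B : ℝ} (hf : support f ⊆ Set.Icc (0 : ℤ) n)
    (hB : ∀ γ ∈ Set.Icc (0 : ℤ) n, |f γ| ≤ B) : |∑ᶠ γ, f γ| ≤ (n + 1) * B := by
  rw [finsum_eq_sum_range (L := n + 1)]
  · refine (Finset.abs_sum_le_sum_abs _ _).trans
      ((Finset.sum_le_card_nsmul _ _ B fun m hm => hB _ ?_).trans (by simp))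
    simp at hm ⊢
    omega
  · intro τ hτ
    obtain ⟨h2, h3⟩ := hf hτ
    exact ⟨h2, by push_cast; omega⟩

/-- The mean of the data of a scheme whose limit is close to a stationary one is close to `1`. -/
lemma eventually_half_le_abs_finsum_refine {N : ℕ} {a : ℕ → ℤ → ℝ} (ha : MasksIn N a)
    {A : ℤ → ℝ} (hA : support A ⊆ Set.Icc (0 : ℤ) N) (hA1 : ∀ α, aryOp 2 A (fun _ => 1) α = 1)
    {φ Φ : ℝ → ℝ} (hφ : IsLimit (fun _ => A) kron φ) (hΦ : IsLimit a kron Φ)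
    (hclose : ∀ x, |Φ x - φ x| ≤ 1 / (6 * (N + 1))) :
    ∀ᶠ m : ℕ in atTop, 1 / 2 * 2 ^ m ≤ |∑ᶠ γ, refine a kron m γ| := by
  have hpos : (0 : ℝ) < 1 / (6 * (N + 1)) := by positivity
  filter_upwards [hφ _ hpos, hΦ _ hpos] with m h1 h2
  have hs1 := support_refine_kron' ha m
  have hs2 := support_refine_kron' (masksIn_const hA) m
  have h3 : |∑ᶠ γ, (refine a kron m γ - refine (fun _ => A) kron m γ)|
      ≤ ((2 ^ m * N : ℕ) + 1) * (1 / (2 * (N + 1))) := by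
    apply abs_finsum_le
    · push_cast
      exact (support_sub _ _).trans (Set.union_subset hs1 hs2)
    · intro γ _
      have e1 := h1 γ
      have e2 := h2 γ
      have e3 := hclose ((γ : ℝ) / 2 ^ m)
      -- Three errors: each data sequence against its limit function, and the two limit functions
      -- against each other.
      have e4 : (1 : ℝ) / (2 * (N + 1)) = 3 * (1 / (6 * (N + 1))) := by field_simp; norm_num
      rw [e4]
      rw [abs_le] at *
      constructor <;> linarith [e1.1, e1.2, e2.1, e2.2, e3.1, e3.2]
  rw [finsum_sub_distrib (finite_support_refine_kron ha m)
    (finite_support_refine_kron (masksIn_const hA) m), finsum_refine_kron hA hA1] at h3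
  have h4 : ((2 ^ m * N : ℕ) + 1 : ℝ) * (1 / (2 * (N + 1))) ≤ 1 / 2 * 2 ^ m := by
    have h5 : (1 : ℝ) ≤ 2 ^ m := one_le_pow₀ (by norm_num)
    push_cast
    rw [mul_one_div, div_le_iff₀ (by positivity)]
    nlinarith
  have h5 := le_abs_self (∑ᶠ γ, refine a kron m γ)
  linarith [(abs_le.1 h3).1]

/-- The moments of the data grow at most like the size of their support allows. -/
lemma eventually_abs_moment_le {N : ℕ} {a : ℕ → ℤ → ℝ} (ha : MasksIn N a) {Φ : ℝ → ℝ}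
    (hc : Continuous Φ) (hΦ : IsLimit a kron Φ) (l : ℕ) :
    ∃ B, ∀ᶠ m : ℕ in atTop, |(∑ᶠ γ : ℤ, (-1 : ℝ) ^ (2 * γ) * (((2 : ℤ) : ℝ) * γ) ^ l
      * refine a kron m γ) / 2 ^ ((m + 1) * (l + 1))| ≤ B := by
  obtain ⟨C, hC1, -, hC⟩ := eventually_abs_refine_kron_le ha hc hΦ
  refine ⟨(N + 1) * (N ^ l * C), ?_⟩
  filter_upwards [hC] with m hm
  rw [abs_div, abs_of_pos (show (0 : ℝ) < 2 ^ ((m + 1) * (l + 1)) by positivity),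
    div_le_iff₀ (by positivity)]
  have h1 := abs_finsum_le (n := 2 ^ m * N) (B := (2 ^ (m + 1) * N) ^ l * C)
    (f := fun γ : ℤ => (-1 : ℝ) ^ (2 * γ) * (((2 : ℤ) : ℝ) * γ) ^ l * refine a kron m γ)
    (fun γ hγ => by
      push_cast
      exact support_refine_kron' ha m (right_ne_zero_of_mul hγ))
    (fun γ hγ => by
      obtain ⟨h2, h3⟩ := hγ
      have h2' : (0 : ℝ) ≤ γ := by exact_mod_cast h2
      have h3' : (γ : ℝ) ≤ 2 ^ m * N := by exact_mod_cast h3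
      rw [abs_mul, abs_mul, abs_zpow, abs_neg, abs_one, one_zpow, one_mul, abs_pow]
      refine mul_le_mul ?_ (hm γ) (abs_nonneg _) (by positivity)
      refine pow_le_pow_left₀ (abs_nonneg _) ?_ l
      rw [abs_of_nonneg (by push_cast; positivity), pow_succ]
      push_cast
      linarith)
  refine h1.trans ?_
  have h5 : (1 : ℝ) ≤ 2 ^ m := one_le_pow₀ (by norm_num)
  have h6 : ((2 ^ m * N : ℕ) + 1 : ℝ) ≤ (N + 1) * 2 ^ (m + 1) := by
    push_cast
    rw [pow_succ]
    nlinarith [Nat.cast_nonneg (α := ℝ) N]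
  calc ((2 ^ m * N : ℕ) + 1 : ℝ) * ((2 ^ (m + 1) * N) ^ l * C)
      ≤ ((N + 1) * 2 ^ (m + 1)) * ((2 ^ (m + 1) * N) ^ l * C) := by gcongr
    _ = (N + 1) * (N ^ l * C) * 2 ^ ((m + 1) * (l + 1)) := by
      rw [mul_pow, show (m + 1) * (l + 1) = (m + 1) * l + (m + 1) by ring,
        pow_add (2 : ℝ) ((m + 1) * l), pow_mul]
      ring

/-! ### Decay passed from samples to data, and from data to masks. -/

lemma tendsto_altMoment_samples {N : ℕ} {Φ : ℕ → ℝ → ℝ} {φ : ℝ → ℝ}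
    (hΦ0 : ∀ k x, x ∉ Set.Icc (0 : ℝ) N → Φ k x = 0) (hφ0 : ∀ x, x ∉ Set.Icc (0 : ℝ) N → φ x = 0)
    (h : ∀ x, Tendsto (fun k => Φ k x) atTop (𝓝 (φ x))) (y : ℝ) (i : ℕ) :
    Tendsto (fun k => altMoment y i fun β => Φ k (y + β)) atTop
      (𝓝 (altMoment y i fun β => φ (y + β))) := by
  have hs : ∀ f : ℝ → ℝ, (∀ x, x ∉ Set.Icc (0 : ℝ) N → f x = 0) →
      altMoment y i (fun β => f (y + β))
        = ∑ β ∈ Finset.Icc ⌈-y⌉ ⌊N - y⌋, (-1 : ℝ) ^ β * (y + β) ^ i * f (y + β) := by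
    intro f hf
    refine finsum_eq_sum_of_support_subset _ fun β hβ => ?_
    have h1 : y + β ∈ Set.Icc (0 : ℝ) N := by
      by_contra hn
      exact right_ne_zero_of_mul hβ (hf _ hn)
    rw [Finset.coe_Icc, Set.mem_Icc, Int.ceil_le, Int.le_floor]
    constructor <;> linarith [h1.1, h1.2]
  simp only [hs _ (hΦ0 _), hs _ hφ0]
  exact tendsto_finsetSum _ fun β _ => (h _).const_mul _

/-- The alternating moments of samples of a compactly supported `C^ℓ` function are small. -/
lemma tendsto_altMoment_dyadic_samples {ℓ N : ℕ} {Φ : ℝ → ℝ} (hΦ : ContDiff ℝ ℓ Φ)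
    (h0 : ∀ x, x ∉ Set.Icc (0 : ℝ) N → Φ x = 0) (y : ℝ) (j : ℕ) :
    Tendsto (fun k : ℕ => (2 : ℝ) ^ (k * ℓ) / 2 ^ (k * (j + 1)) *
      altMoment y j fun β => Φ ((y + β) / 2 ^ k)) atTop (𝓝 0) := by
  -- The polynomial weight is absorbed into the function; rescaling it costs `2 ^ (k * j)`.
  have hf : ContDiff ℝ ℓ (fun x => x ^ j * Φ x) := (contDiff_id.pow j).mul hΦ
  have h0' : ∀ x, x ∉ Set.Icc (0 : ℝ) N → x ^ j * Φ x = 0 := fun x hx => by rw [h0 x hx, mul_zero]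
  have hA : ∀ k : ℕ, (altMoment y j fun β => Φ ((y + β) / 2 ^ k))
      = 2 ^ (k * j) * altSum ((1 / 2) ^ k) (fun x => x ^ j * Φ x) (y / 2 ^ k) := by
    intro k
    rw [altMoment, altSum, mul_finsum]
    refine finsum_congr fun β => ?_
    have e1 : y / 2 ^ k + (1 / 2) ^ k * β = (y + β) / 2 ^ k := by
      rw [one_div_pow]; ring
    rw [e1, div_pow, ← pow_mul]
    field_simp
  rw [Metric.tendsto_nhds]
  intro ε hε
  obtain ⟨h₀, hpos, hh⟩ := exists_mul_abs_altSum_le hf (Nat.cast_nonneg N) h0'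
    (show 0 < ε / 2 by positivity)
  filter_upwards [(tendsto_pow_atTop_nhds_zero_of_lt_one (r := (1 / 2 : ℝ)) (by norm_num)
    (by norm_num)).eventually (gt_mem_nhds hpos)] with k hk
  have h1 := hh _ (by positivity) hk (y / 2 ^ k)
  rw [Real.dist_eq, sub_zero, hA]
  set S := altSum ((1 / 2) ^ k) (fun x => x ^ j * Φ x) (y / 2 ^ k)
  have e2 : (2 : ℝ) ^ (k * ℓ) / 2 ^ (k * (j + 1)) * (2 ^ (k * j) * S)
      = 2 ^ (k * ℓ) * ((1 / 2) ^ k * S) := by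
    rw [mul_add, pow_add, one_div_pow, mul_one]
    field_simp
  rw [e2, abs_mul, abs_mul, abs_of_pos (show (0 : ℝ) < 2 ^ (k * ℓ) by positivity),
    abs_of_pos (show (0 : ℝ) < (1 / 2) ^ k by positivity)]
  calc 2 ^ (k * ℓ) * ((1 / 2) ^ k * |S|) ≤ 2 ^ (k * ℓ) * (ε / 2 * ((1 / 2) ^ k) ^ ℓ) := by gcongr
    _ = ε / 2 := by rw [← pow_mul, one_div_pow]; field_simp
    _ < ε := by linarith

/-- The alternating moments of the data of a `C^ℓ` scheme are small. -/
lemma tendsto_altMoment_refine {ℓ N : ℕ} {a : ℕ → ℤ → ℝ} (ha : MasksIn N a)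
    {Φ : ℕ → ℝ → ℝ} (hΦℓ : ContDiff ℝ ℓ (Φ 0)) (hΦ : ∀ k, Continuous (Φ k))
    (hΦl : ∀ k, IsLimit (tailMasks k a) kron (Φ k)) {φ : ℝ → ℝ}
    (hφ0 : ∀ x, x ∉ Set.Icc (0 : ℝ) N → φ x = 0)
    (h : ∀ x, Tendsto (fun k => Φ k x) atTop (𝓝 (φ x))) {y : ℝ}
    (hy : (altMoment y 0 fun β => φ (y + β)) ≠ 0) (j : ℕ) (hj : j ≤ ℓ) :
    Tendsto (fun k : ℕ => (2 : ℝ) ^ (k * ℓ) / 2 ^ (k * (j + 1)) *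
      altMoment 0 j (refine a kron k)) atTop (𝓝 0) := by
  have hΦ0 : ∀ k x, x ∉ Set.Icc (0 : ℝ) N → Φ k x = 0 := fun k x hx =>
    isLimit_kron_eq_zero (ha.tail k) (hΦ k) (hΦl k) hx
  have ht := tendsto_altMoment_samples hΦ0 hφ0 h y
  have hl0 : IsLimit a kron (Φ 0) := by
    convert hΦl 0 using 1
    funext i; simp [tailMasks]
  -- The normalisations multiply to `2 ^ (k * (j + 1))` along `p.1 + p.2 = j`. The diagonal
  -- coefficient `Z k 0` tends to the nonzero number in `hy`.
  refine tendsto_zero_of_binomial_convolution (ℓ := ℓ)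
    (Y := fun k j => (2 : ℝ) ^ (k * ℓ) / 2 ^ (k * (j + 1)) * altMoment 0 j (refine a kron k))
    (Z := fun k i => (altMoment y i fun β => Φ k (y + β)) / 2 ^ (k * i))
    (c := |altMoment y 0 fun β => φ (y + β)| / 2) ?_ (by positivity) ?_ ?_ j hj
  · intro i
    refine ⟨|altMoment y i fun β => φ (y + β)| + 1, ?_⟩
    filter_upwards [(ht i).abs.eventually (gt_mem_nhds (lt_add_one _))] with k hk
    rw [abs_div, abs_of_pos (show (0 : ℝ) < 2 ^ (k * i) by positivity)]
    exact (div_le_self (abs_nonneg _) (one_le_pow₀ (by norm_num))).trans hk.le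
  · filter_upwards [(ht 0).abs.eventually (lt_mem_nhds (half_lt_self (abs_pos.2 hy)))] with k hk
    simpa using hk.le
  · intro j _
    refine (tendsto_altMoment_dyadic_samples hΦℓ (hΦ0 0) y j).congr fun k => ?_
    have e1 : (fun β : ℤ => Φ 0 ((y + β) / 2 ^ k))
        = aryOp 1 (fun β : ℤ => Φ k (y + β)) (refine a kron k) := by
      funext β
      rw [isLimit_kron_refinement ha (hΦ 0) hl0 (hΦ k) (hΦl k), aryOp]
      refine finsum_congr fun γ => ?_
      congr 2
      push_cast
      field_simp
      ring
    have hfin : (support fun β : ℤ => Φ k (y + β)).Finite := by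
      refine (Set.finite_Icc ⌈-y⌉ ⌊N - y⌋).subset fun β hβ => ?_
      have h1 : y + β ∈ Set.Icc (0 : ℝ) N := by
        by_contra hn
        exact hβ (hΦ0 k _ hn)
      rw [Set.mem_Icc, Int.ceil_le, Int.le_floor]
      constructor <;> linarith [h1.1, h1.2]
    rw [e1, altMoment_aryOp 1 y j hfin (finite_support_refine_kron ha k), Finset.mul_sum]
    refine Finset.sum_congr rfl fun p hp => ?_
    rw [Finset.HasAntidiagonal.mem_antidiagonal] at hp
    have e2 : (∑ᶠ γ : ℤ, (-1 : ℝ) ^ (1 * γ) * (((1 : ℤ) : ℝ) * γ) ^ p.1 * refine a kron k γ)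
        = altMoment 0 p.1 (refine a kron k) := by
      refine finsum_congr fun γ => ?_
      simp
    have e3 : (2 : ℝ) ^ (k * (j + 1)) = 2 ^ (k * (p.1 + 1)) * 2 ^ (k * p.2) := by
      rw [← pow_add, ← hp]; ring
    rw [e2, e3]
    field_simp

/-- The alternating moments of the masks of a `C^ℓ` scheme are small. -/
lemma tendsto_altMoment_mask {ℓ N : ℕ} {a : ℕ → ℤ → ℝ} (ha : MasksIn N a)
    {A : ℤ → ℝ} (hA : support A ⊆ Set.Icc (0 : ℤ) N) (hA1 : ∀ α, aryOp 2 A (fun _ => 1) α = 1)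
    {Φ : ℕ → ℝ → ℝ} (hΦℓ : ContDiff ℝ ℓ (Φ 0)) (hΦ : ∀ k, Continuous (Φ k))
    (hΦl : ∀ k, IsLimit (tailMasks k a) kron (Φ k)) {φ : ℝ → ℝ}
    (hφ0 : ∀ x, x ∉ Set.Icc (0 : ℝ) N → φ x = 0) (hφl : IsLimit (fun _ => A) kron φ)
    (h : ∀ x, Tendsto (fun k => Φ k x) atTop (𝓝 (φ x)))
    (hclose : ∀ x, |Φ 0 x - φ x| ≤ 1 / (6 * (N + 1))) {y : ℝ}
    (hy : (altMoment y 0 fun β => φ (y + β)) ≠ 0) (j : ℕ) (hj : j ≤ ℓ) :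
    Tendsto (fun k : ℕ => (2 : ℝ) ^ (k * ℓ) / 2 ^ (k * j) * altMoment 0 j (a k)) atTop (𝓝 0) := by
  have hl0 : IsLimit a kron (Φ 0) := by
    convert hΦl 0 using 1
    funext i; simp [tailMasks]
  rw [← tendsto_add_atTop_iff_nat 1]
  -- The constant `1 / 4` is the lower bound `2 ^ m / 2` for the total mass of the data, divided by
  -- `2 ^ (m + 1)`.
  refine tendsto_zero_of_binomial_convolution (ℓ := ℓ) (c := 1 / 4)
    (Y := fun m j => (2 : ℝ) ^ ((m + 1) * ℓ) / 2 ^ ((m + 1) * j) * altMoment 0 j (a (m + 1)))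
    (Z := fun m l => (∑ᶠ γ : ℤ, (-1 : ℝ) ^ (2 * γ) * (((2 : ℤ) : ℝ) * γ) ^ l
      * refine a kron m γ) / 2 ^ ((m + 1) * (l + 1))) ?_ (by norm_num) ?_ ?_ j hj
  · exact fun i => eventually_abs_moment_le ha (hΦ 0) hl0 i
  · filter_upwards [eventually_half_le_abs_finsum_refine ha hA hA1 hφl hl0 hclose] with m hm
    have e1 : (∑ᶠ γ : ℤ, (-1 : ℝ) ^ (2 * γ) * (((2 : ℤ) : ℝ) * γ) ^ 0 * refine a kron m γ)
        = ∑ᶠ γ, refine a kron m γ := by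
      refine finsum_congr fun γ => ?_
      simp [zpow_mul]
    rw [e1, abs_div, abs_of_pos (show (0 : ℝ) < 2 ^ ((m + 1) * (0 + 1)) by positivity),
      le_div_iff₀ (by positivity), zero_add, mul_one, pow_succ]
    linarith
  · intro j hj
    have ht := (tendsto_add_atTop_iff_nat 1).2
      (tendsto_altMoment_refine ha hΦℓ hΦ hΦl hφ0 h hy j hj)
    refine ht.congr fun m => ?_
    have h2 : refine a kron (m + 1) = aryOp 2 (a (m + 1)) (refine a kron m) := rfl
    rw [h2, altMoment_aryOp 2 0 j (finite_support_of_subset_Icc (ha (m + 1) (by omega)))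
      (finite_support_refine_kron ha m), Finset.mul_sum, ← Finset.Nat.sum_antidiagonal_swap]
    refine Finset.sum_congr rfl fun p hp => ?_
    rw [Finset.HasAntidiagonal.mem_antidiagonal] at hp
    have e3 : (2 : ℝ) ^ ((m + 1) * (j + 1)) = 2 ^ ((m + 1) * (p.2 + 1)) * 2 ^ ((m + 1) * p.1) := by
      rw [← pow_add, ← hp]; ring
    simp only [Prod.fst_swap, Prod.snd_swap]
    rw [e3, Nat.choose_symm_of_eq_add hp.symm]
    field_simp

/-! ### From alternating moments to sum rule defects. -/

lemma symbol_eq_sum {N : ℕ} {b : ℤ → ℝ} (hb : support b ⊆ Set.Icc (0 : ℤ) N) :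
    symbol b = fun z => ∑ n ∈ Finset.range (N + 1), (b n : ℂ) * z ^ n := by
  funext z
  rw [symbol, finsum_eq_sum_of_support_subset
    (s := (Finset.range (N + 1)).image fun n : ℕ => (n : ℤ)),
    Finset.sum_image (by intro x _ y _ h; simpa using h)]
  · simp
  · intro τ hτ
    have h1 : b τ ≠ 0 := fun h => hτ (by simp [h])
    obtain ⟨h2, h3⟩ := hb h1
    simp only [Finset.coe_image, Finset.coe_range, Set.mem_image, Set.mem_Iio]
    exact ⟨τ.toNat, by omega, by omega⟩

/-- The derivatives of the symbol at `-1` are combinations of alternating moments. -/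
lemma norm_iteratedDeriv_symbol_le {N : ℕ} {b : ℤ → ℝ} (hb : support b ⊆ Set.Icc (0 : ℤ) N)
    (j : ℕ) : ‖iteratedDeriv j (symbol b) (-1)‖ ≤ ∑ l ∈ Finset.range (j + 1),
      |(descPochhammer ℝ j).coeff l| * |altMoment 0 l b| := by
  have h1 : iteratedDeriv j (symbol b) (-1)
      = (-1) ^ j * ((∑ n ∈ Finset.range (N + 1), (-1 : ℝ) ^ n * n.descFactorial j * b n : ℝ) : ℂ) := by
    rw [symbol_eq_sum hb, iteratedDeriv_fun_sum (fun n _ => by fun_prop), Complex.ofReal_sum,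
      Finset.mul_sum]
    refine Finset.sum_congr rfl fun n _ => ?_
    rw [iteratedDeriv_const_mul_field, iteratedDeriv_pow]
    push_cast
    by_cases hn : j ≤ n
    · obtain ⟨m, rfl⟩ := Nat.exists_eq_add_of_le hn
      rw [Nat.add_sub_cancel_left, pow_add]
      have : ((-1 : ℂ) ^ j) * (-1) ^ j = 1 := by rw [← mul_pow]; simp
      linear_combination (-(b (↑(j + m) : ℤ) : ℂ) * ((j + m).descFactorial j) * (-1) ^ m) * this
    -- For `n < j` the exponent `n - j` is truncated to `0`, but the falling factorial vanishes.
    · rw [Nat.descFactorial_eq_zero_iff_lt.2 (by omega)]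
      simp
  have h2 : ∑ n ∈ Finset.range (N + 1), (-1 : ℝ) ^ n * n.descFactorial j * b n
      = ∑ l ∈ Finset.range (j + 1), (descPochhammer ℝ j).coeff l * altMoment 0 l b := by
    have h3 : ∀ l, altMoment 0 l b = ∑ n ∈ Finset.range (N + 1), (-1 : ℝ) ^ n * (n : ℝ) ^ l * b n := by
      intro l
      rw [altMoment, finsum_eq_sum_range (L := N + 1)]
      · simp
      · intro τ hτ
        obtain ⟨h4, h5⟩ := hb (right_ne_zero_of_mul hτ)
        exact ⟨h4, by push_cast; omega⟩
    simp only [h3, Finset.mul_sum]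
    rw [Finset.sum_comm]
    refine Finset.sum_congr rfl fun n _ => ?_
    rw [← descPochhammer_eval_eq_descFactorial ℝ n j, Polynomial.eval_eq_sum_range,
      descPochhammer_natDegree, Finset.mul_sum, Finset.sum_mul]
    refine Finset.sum_congr rfl fun l _ => ?_
    ring
  rw [h1, norm_mul, norm_pow, norm_neg, norm_one, one_pow, one_mul, Complex.norm_real,
    Real.norm_eq_abs, h2]
  refine (Finset.abs_sum_le_sum_abs _ _).trans (Finset.sum_le_sum fun l _ => ?_)
  rw [abs_mul]

/-- The derivative of order `j` involves only moments of order `l ≤ j`, for which the weight `2 ^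
(-k * j)` is at most `2 ^ (-k * l)`. -/
lemma tendsto_sumRuleDefect {ℓ N : ℕ} {a : ℕ → ℤ → ℝ} (ha : MasksIn N a)
    (h : ∀ j, j ≤ ℓ → Tendsto (fun k : ℕ => (2 : ℝ) ^ (k * ℓ) / 2 ^ (k * j) *
      altMoment 0 j (a k)) atTop (𝓝 0)) :
    Tendsto (fun k : ℕ => (2 : ℝ) ^ (ℓ * k) * sumRuleDefect ℓ k (a k)) atTop (𝓝 0) := by
  have hb : Tendsto (fun k : ℕ => ∑ j ∈ Finset.range (ℓ + 1), ∑ l ∈ Finset.range (j + 1),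
      |(descPochhammer ℝ j).coeff l| * |(2 : ℝ) ^ (k * ℓ) / 2 ^ (k * l) * altMoment 0 l (a k)|)
      atTop (𝓝 0) := by
    suffices key : Tendsto (fun k : ℕ => ∑ j ∈ Finset.range (ℓ + 1), ∑ l ∈ Finset.range (j + 1),
        |(descPochhammer ℝ j).coeff l| * |(2 : ℝ) ^ (k * ℓ) / 2 ^ (k * l) * altMoment 0 l (a k)|)
        atTop (𝓝 (∑ j ∈ Finset.range (ℓ + 1), ∑ l ∈ Finset.range (j + 1), (0 : ℝ))) by
      simpa only [Finset.sum_const_zero] using key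
    refine tendsto_finsetSum _ fun j hj => tendsto_finsetSum _ fun l hl => ?_
    simp only [Finset.mem_range] at hj hl
    simpa using (h l (by omega)).abs.const_mul |(descPochhammer ℝ j).coeff l|
  refine squeeze_zero_norm' ?_ hb
  -- Nothing is assumed about the support of `a 0`.
  filter_upwards [eventually_ge_atTop 1] with k hk
  have h0 : 0 ≤ sumRuleDefect ℓ k (a k) := by
    refine le_trans ?_ (Finset.le_sup' _ (Finset.mem_range.2 (Nat.succ_pos ℓ)))
    positivity
  rw [Real.norm_eq_abs, abs_of_nonneg (by positivity), mul_comm, ← le_div_iff₀ (by positivity)]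
  refine Finset.sup'_le _ _ fun j hj => ?_
  rw [le_div_iff₀ (by positivity)]
  refine le_trans ?_ (Finset.single_le_sum (f := fun j => ∑ l ∈ Finset.range (j + 1),
      |(descPochhammer ℝ j).coeff l| * |(2 : ℝ) ^ (k * ℓ) / 2 ^ (k * l) * altMoment 0 l (a k)|)
      (fun i _ => by positivity) hj)
  have h1 := norm_iteratedDeriv_symbol_le (ha k hk) j
  calc ‖iteratedDeriv j (symbol (a k)) (-1)‖ / 2 ^ (k * j) * 2 ^ (ℓ * k)
      ≤ (∑ l ∈ Finset.range (j + 1), |(descPochhammer ℝ j).coeff l| * |altMoment 0 l (a k)|)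
        / 2 ^ (k * j) * 2 ^ (ℓ * k) := by gcongr
    _ = ∑ l ∈ Finset.range (j + 1), |(descPochhammer ℝ j).coeff l| *
        (2 ^ (k * ℓ) / 2 ^ (k * j) * |altMoment 0 l (a k)|) := by
      rw [Finset.sum_div, Finset.sum_mul, mul_comm ℓ k]
      refine Finset.sum_congr rfl fun l _ => by ring
    _ ≤ _ := by
      refine Finset.sum_le_sum fun l hl => ?_
      rw [abs_mul, abs_of_pos (show (0 : ℝ) < 2 ^ (k * ℓ) / 2 ^ (k * l) by positivity)]
      have : l ≤ j := by simp at hl; omega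
      gcongr
      norm_num

/-- The lower stability bound is tested on `(-1) ^ α`: if every alternating sum of integer
translates were zero, this bounded nonzero sequence would violate it. -/
lemma exists_alternating_sum_ne_zero {f : ℝ → ℝ} (hf : IsStable f) :
    ∃ y : ℝ, (altMoment y 0 fun β => f (y + β)) ≠ 0 := by
  obtain ⟨-, -, C₁, C₂, h1, -, h2⟩ := hf
  by_contra! hz
  have h3 := (h2 (fun α => (-1 : ℝ) ^ α) ⟨1, fun α => by simp [abs_zpow]⟩).1
  have h4 : (fun x : ℝ => ∑ᶠ α : ℤ, (-1 : ℝ) ^ α * f (x - α)) = 0 := by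
    funext x
    rw [← finsum_comp_equiv (Equiv.neg ℤ)]
    simpa [altMoment, zpow_neg, ← inv_zpow] using hz x
  rw [h4, eLpNorm_zero, nonpos_iff_eq_zero, mul_eq_zero] at h3
  rcases h3 with h3 | h3
  · simp at h3; exact h1.ne' h3
  · rw [ENNReal.iSup_eq_zero] at h3
    simpa using h3 0

end Subdivision

open Subdivision

/-! ### Assembly. -/

theorem theorem1 (ℓ N : ℕ) (a : ℕ → ℤ → ℝ) (aLim : ℤ → ℝ) (φ : ℝ → ℝ)
    (hsupp : ∀ k : ℕ, 1 ≤ k → Function.support (a k) ⊆ Set.Icc (0 : ℤ) (N : ℤ))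
    (hlim : ∀ α : ℤ, Tendsto (fun k => a k α) atTop (𝓝 (aLim α)))
    (hstat : Subdivision.ConvergesToLimits 0 (fun _ => aLim))
    (hbasic : Subdivision.IsBasicLimitFunction aLim φ)
    (hstable : Subdivision.IsStable φ)
    (hconv : Subdivision.ConvergesToLimits ℓ a) :
    Tendsto (fun k : ℕ => (2 : ℝ) ^ (ℓ * k) * Subdivision.sumRuleDefect ℓ k (a k))
      atTop (𝓝 0) := by
  have ha : MasksIn N a := hsupp
  obtain ⟨hφ, hφl⟩ := hbasic
  change IsLimit (fun _ => aLim) kron φ at hφl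
  have hA : Function.support aLim ⊆ Set.Icc (0 : ℤ) N := by
    intro x hx
    by_contra hn
    refine hx (tendsto_nhds_unique (hlim x) (tendsto_const_nhds.congr' ?_))
    filter_upwards [eventually_ge_atTop 1] with k hk
    by_contra h
    exact hn (ha k hk (Ne.symm h))
  obtain ⟨y, hy⟩ := exists_alternating_sum_ne_zero hstable
  have hφne : ∃ x, φ x ≠ 0 := by
    by_contra! h
    exact hy (by simp [altMoment, h])
  have hφ0 : ∀ x, x ∉ Set.Icc (0 : ℝ) N → φ x = 0 := fun x hx =>
    isLimit_kron_eq_zero (masksIn_const hA) hφ hφl hx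
  obtain ⟨hall, c, g, -, -, hg, hgl, hg0⟩ := hconv
  obtain ⟨x₀, hx₀⟩ := Function.ne_iff.1 hg0
  obtain ⟨Ψ, hΨ, hΨl⟩ := hall kron ⟨1, fun α => by by_cases h : α = 0 <;> simp [kron, h]⟩
  choose Φ hΦℓ hΦl using fun k => exists_isLimit_tail ha
    (fun m hm => mask_ne_zero_of_isLimit hg.continuous hgl hg0 hm) hΨ hΨl k
  have hclose := fun ε (hε : 0 < ε) => eventually_abs_limit_tail_sub_le ha hA hlim hφ hφl hφne
    hg.continuous hgl ⟨x₀, hx₀⟩ (fun k => (hΦℓ k).continuous) hΦl (ε := ε) hε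
  have ht : ∀ x, Tendsto (fun k => Φ k x) atTop (𝓝 (φ x)) := by
    intro x
    rw [Metric.tendsto_nhds]
    intro ε hε
    filter_upwards [hclose (ε / 2) (by positivity)] with k hk
    rw [Real.dist_eq]
    linarith [hk x]
  -- Restarting at level `K` brings the basic limit function close enough to `φ` to bound the total
  -- mass of the data from below.
  obtain ⟨K, hK⟩ := (hclose (1 / (6 * (N + 1))) (by positivity)).exists
  obtain ⟨x₁, hx₁⟩ := hφne
  refine tendsto_sumRuleDefect ha fun j hj => ?_
  have h := tendsto_altMoment_mask (ha.tail K) hA (aryOp_two_one_of_isLimit hA hφ hφl hx₁)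
    (Φ := fun k => Φ (K + k)) (hΦℓ K) (fun k => (hΦℓ _).continuous)
    (fun k => by rw [tailMasks_tailMasks]; exact hΦl _) hφ0 hφl
    (fun x => by
      have := (tendsto_add_atTop_iff_nat K).2 (ht x)
      simpa only [add_comm] using this) hK hy j hj
  -- Undoing the restart multiplies the normalised moments by a constant independent of `k`.
  rw [← tendsto_add_atTop_iff_nat K]
  have h2 := h.const_mul ((2 : ℝ) ^ (K * ℓ) / 2 ^ (K * j))
  rw [mul_zero] at h2
  refine h2.congr fun k => ?_
  rw [add_comm k K, add_mul, add_mul, pow_add, pow_add, tailMasks]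
  ring
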